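/- **Setting.** Let $n\ge 2$, $N=2n+1$, $r\ge 1$. For $\theta=[a^\top,\tau^\top]^\top$ with amplitudes $a\in\mathbb{C}^r$ and locations $\tau\in\mathbb{R}^r$, and a ground truth $\theta^\star=[a^{\star\top},\tau^{\star\top}]^\top$ with $a^\star_j\neq 0$ for all $j$, let $$\mathcal{L}(\theta)=\frac12\sum_{k=-n}^{n} g_k^2\,\Big|\sum_{\ell=1}^r a_\ell e^{-2\pi i k\tau_\ell}-\sum_{\ell=1}^r a^\star_\ell e^{-2\pi i k\tau^\star_\ell}\Big|^2,\qquad g_k^2=\frac{1}{n+1}\Big(1-\frac{|k|}{n+1}\Big),$$ and let $F_N(t)=\sum_{k=-n}^n g_k^2e^{2\pi i kt}$ be the normalized Fejér kernel, so that $-F_N''(0)=\frac23\pi^2n(n+2)>0$. Let $$H(\theta)=\begin{bmatrix}H_{a,a}&H_{a,\tau}\\ H_{a,\tau}^{\mathsf H}&H_{\tau,\tau}\end{bmatrix}\in\mathbb{C}^{2r\times 2r}$$ be the Hessian of $\mathcal{L}$ at $\theta$: with the amplitude gradient $\frac{d\mathcal L}{da_i}=\partial_{\Re a_i}\mathcal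 L+i\,\partial_{\Im a_i}\mathcal L$, the entries are $[H_{a,a}]_{ij}=\frac{d}{da_j}\frac{d\mathcal L}{da_i}$ (complex derivative), $[H_{a,\tau}]_{ij}=\frac{d}{d\tau_j}\frac{d\mathcal L}{da_i}$ and $[H_{\tau,\tau}]_{ij}=\frac{d^2\mathcal L}{d\tau_i\,d\tau_j}$. Let $$\Delta(\tau^\star)=\min_{\ell\ne\ell'}\inf_{p\in\mathbb{Z}}|\tau^\star_\ell-\tau^\star_{\ell'}+p|$$ be the minimal wrap-around distance (equal to $+\infty$, with $(+\infty)^{-2}=0$, if $r=1$), $\|a^\star\|_\infty=\max_j|a^\star_j|$ and $a^\star_{\min}=\min_j|a^\star_j|$. For a point $\theta_k=[a_k^\top,\tau_k^\top]^\top$ with $a_k\in\mathbb C^r$, $\tau_k\in\mathbb R^r$, put $$S=\mathrm{diag}\begin{bmatrix}(a^\star)^{-1}\\ \sqrt{-F_N''(0)}\,\mathbf 1_r\end{bmatrix},\qquad P_k=\mathrm{diag}\begin{bmatrix}\mathbf 1_r\\ -F_N''(0)^{-1}|a_k|^{-2}\end{bmatrix},\qquad \varepsilon=\|S(\theta_k-\theta^\star)\|_\infty,$$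 where inverses and moduli of vectors are entrywise, and let $\mathcal S_k=\{\theta^\star+u(\theta_k-\theta^\star):u\in[0,1]\}$. Matrix norms $\|\cdot\|_\infty$ are maximal absolute row sums. **Theorem.** There exist two positive constants $K_\Delta\le 2.32$ and $K_\theta\le 75.80$ (independent of $n$, $r$, $\theta^\star$, $\theta_k$) such that, whenever $n\ge 2$, $(n+1)\Delta(\tau^\star)\ge 4.7$ and $\varepsilon<1$, every $\theta=[a^\top,\tau^\top]^\top\in\mathcal S_k$ with $\|\tau-\tau^\star\|_\infty\le\frac14\Delta(\tau^\star)$ satisfies $$\|S P_k H(\theta) S^{-1}-I\|_\infty\le\frac{1}{(1-\varepsilon)^2}-1+\big(4K_\Delta+K_\theta\,\varepsilon\big)\frac{\|a^\star\|_\infty}{a^\star_{\min}}\,\frac{\big((n+1)\Delta(\tau^\star)\big)^{-2}}{(1-\varepsilon)^2}.$$ -/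

import Mathlib

open scoped ENNReal Matrix Matrix.Norms.Operator

noncomputable section

namespace SpikeDeconv

/-- Parameters of `r` spikes: `θ.1` are the complex amplitudes, `θ.2` the real locations. -/
abbrev Param (r : ℕ) : Type := (Fin r → ℂ) × (Fin r → ℝ)

/-- The stacked vector `[a; τ] ∈ ℂ^{2r}`. -/
def toVec {r : ℕ} (θ : Param r) : Fin r ⊕ Fin r → ℂ :=
  Sum.elim θ.1 (fun j => (θ.2 j : ℂ))

/-- The normalized Fejér kernel `(n+1)⁻¹ ∑_{|k| ≤ n} (1 - |k|/(n+1)) e^{2iπkt}`, written with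
cosines because the imaginary parts cancel. -/
def fejer (n : ℕ) (t : ℝ) : ℝ :=
  (1 / ((n : ℝ) + 1)) * ∑ k ∈ Finset.Icc (-(n : ℤ)) n,
    (1 - |(k : ℝ)| / ((n : ℝ) + 1)) * Real.cos (2 * Real.pi * k * t)

/-- The positive number `-F_N''(0)`. -/
def curv (n : ℕ) : ℝ := -iteratedDeriv 2 (fejer n) 0

/-- The `k`-th Fourier weight of the point spread function. -/
def weight (n : ℕ) (k : ℤ) : ℝ :=
  Real.sqrt (1 / ((n : ℝ) + 1) * (1 - |(k : ℝ)| / ((n : ℝ) + 1)))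

/-- The `k`-th entry (`|k| ≤ n`) of the observation of the measure `∑ ℓ, a_ℓ δ_{τ_ℓ}`: its
Fourier coefficient at frequency `k`, multiplied by the weight. -/
def obs (n : ℕ) {r : ℕ} (θ : Param r) (k : ℤ) : ℂ :=
  (weight n k : ℂ) *
    ∑ l, θ.1 l * Complex.exp (-(2 * Real.pi * k * θ.2 l : ℝ) * Complex.I)

/-- The least-squares loss for data generated by the ground truth `θs`. -/
def loss (n : ℕ) {r : ℕ} (θs θ : Param r) : ℝ :=
  (1 / 2) * ∑ k ∈ Finset.Icc (-(n : ℤ)) n, ‖obs n θ k - obs n θs k‖ ^ 2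

/-- The gradient of a real-valued function in the complex amplitude `a_i`: the partial derivative
in `Re a_i` plus `I` times the partial derivative in `Im a_i`. -/
def gradAmp {r : ℕ} (f : Param r → ℝ) (θ : Param r) (i : Fin r) : ℂ :=
  ((deriv (fun x : ℝ => f (Function.update θ.1 i (θ.1 i + x), θ.2)) 0 : ℝ) : ℂ) +
    ((deriv (fun y : ℝ => f (Function.update θ.1 i (θ.1 i + y * Complex.I), θ.2)) 0 : ℝ) : ℂ) *
      Complex.I

/-- The partial derivative in the real location `τ_i`. -/
def gradLoc {r : ℕ} (f : Param r → ℝ) (θ : Param r) (i : Fin r) : ℝ :=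
  deriv (fun t : ℝ => f (θ.1, Function.update θ.2 i t)) (θ.2 i)

/-- Amplitude-amplitude block: complex derivative in `a_j` of the gradient in `a_i` (for the
loss above this gradient is an affine function of the complex variable `a_j`). -/
def hessAA {r : ℕ} (f : Param r → ℝ) (θ : Param r) : Matrix (Fin r) (Fin r) ℂ :=
  Matrix.of fun i j =>
    deriv (fun z : ℂ => gradAmp f (Function.update θ.1 j z, θ.2) i) (θ.1 j)

/-- Amplitude-location block: derivative in `τ_j` of the gradient in `a_i`. -/
def hessAT {r : ℕ} (f : Param r → ℝ) (θ : Param r) : Matrix (Fin r) (Fin r) ℂ :=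
  Matrix.of fun i j =>
    deriv (fun t : ℝ => gradAmp f (θ.1, Function.update θ.2 j t) i) (θ.2 j)

/-- Location-location block: second partial derivatives in `τ_i` and `τ_j`. -/
def hessTT {r : ℕ} (f : Param r → ℝ) (θ : Param r) : Matrix (Fin r) (Fin r) ℂ :=
  Matrix.of fun i j =>
    ((deriv (fun t : ℝ => gradLoc f (θ.1, Function.update θ.2 j t) i) (θ.2 j) : ℝ) : ℂ)

/-- The Hessian `∇²f(θ) ∈ ℂ^{2r × 2r}`. -/
def hessian {r : ℕ} (f : Param r → ℝ) (θ : Param r) :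
    Matrix (Fin r ⊕ Fin r) (Fin r ⊕ Fin r) ℂ :=
  Matrix.fromBlocks (hessAA f θ) (hessAT f θ) (hessAT f θ)ᴴ (hessTT f θ)

/-- The weighting matrix `S = diag(1 / a*, √(-F_N''(0)))`. -/
def scaling (n : ℕ) {r : ℕ} (θs : Param r) : Matrix (Fin r ⊕ Fin r) (Fin r ⊕ Fin r) ℂ :=
  Matrix.diagonal (Sum.elim (fun j => (θs.1 j)⁻¹) (fun _ => ((Real.sqrt (curv n) : ℝ) : ℂ)))

/-- The adaptive preconditioner `P_k = diag(1, (-F_N''(0))⁻¹ |a_k|⁻²)` at the iterate `θk`. -/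
def precond (n : ℕ) {r : ℕ} (θk : Param r) : Matrix (Fin r ⊕ Fin r) (Fin r ⊕ Fin r) ℂ :=
  Matrix.diagonal
    (Sum.elim (fun _ => 1) (fun j => (((curv n)⁻¹ * (‖θk.1 j‖ ^ 2)⁻¹ : ℝ) : ℂ)))

/-- The weighted error `‖S (θk - θ*)‖_∞` (the norm on `Fin r ⊕ Fin r → ℂ` is the sup norm). -/
def err (n : ℕ) {r : ℕ} (θs θk : Param r) : ℝ :=
  ‖scaling n θs *ᵥ (toVec θk - toVec θs)‖

/-- The minimal wrap-around distance `min_{ℓ ≠ ℓ'} inf_{p ∈ ℤ} |τ_ℓ - τ_ℓ' + p|`; it is `∞` for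
a single point. -/
def sep {r : ℕ} (τ : Fin r → ℝ) : ℝ≥0∞ :=
  ⨅ (l : Fin r) (l' : Fin r) (_ : l ≠ l'), ENNReal.ofReal (⨅ p : ℤ, |τ l - τ l' + p|)

/-- The dynamic range `max |a_ℓ| / min |a_ℓ|` of the amplitudes. -/
def dynRange {r : ℕ} (a : Fin r → ℂ) : ℝ := (⨆ l, ‖a l‖) / (⨅ l, ‖a l‖)

end SpikeDeconv

end

namespace SpikeDeconv

/-! ### The Fejér kernel and its derivatives -/

/-- The squared Fourier weight `g_k ^ 2`. -/
noncomputable def sqWeight (n : ℕ) (k : ℤ) : ℝ :=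
  1 / ((n : ℝ) + 1) * (1 - |(k : ℝ)| / ((n : ℝ) + 1))

/-- The `m`-th derivative of the normalized Fejér kernel. -/
noncomputable def fejerDeriv (n m : ℕ) (t : ℝ) : ℝ :=
  ∑ k ∈ Finset.Icc (-(n : ℤ)) n,
    sqWeight n k * (2 * Real.pi * k) ^ m * Real.cos (2 * Real.pi * k * t + m * (Real.pi / 2))

lemma sqWeight_neg (n : ℕ) (k : ℤ) : sqWeight n (-k) = sqWeight n k := by
  simp [sqWeight]

lemma sqWeight_nonneg {n : ℕ} {k : ℤ} (hk : k ∈ Finset.Icc (-(n : ℤ)) n) :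
    0 ≤ sqWeight n k := by
  rw [Finset.mem_Icc] at hk
  have h1 : |(k : ℝ)| ≤ n := by
    rw [abs_le]; exact ⟨by exact_mod_cast hk.1, by exact_mod_cast hk.2⟩
  have h2 : (0 : ℝ) < (n : ℝ) + 1 := by positivity
  have h3 : |(k : ℝ)| / ((n : ℝ) + 1) ≤ 1 := by
    rw [div_le_one h2]; linarith
  unfold sqWeight
  exact mul_nonneg (by positivity) (by linarith)

lemma weight_mul_self {n : ℕ} {k : ℤ} (hk : k ∈ Finset.Icc (-(n : ℤ)) n) :
    weight n k * weight n k = sqWeight n k :=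
  Real.mul_self_sqrt (sqWeight_nonneg hk)

lemma fejerDeriv_zero (n : ℕ) : fejerDeriv n 0 = fejer n := by
  funext t
  simp only [fejerDeriv, fejer, sqWeight, Finset.mul_sum]
  refine Finset.sum_congr rfl fun k _ => ?_
  simp
  ring

lemma hasDerivAt_fejerDeriv (n m : ℕ) (t : ℝ) :
    HasDerivAt (fejerDeriv n m) (fejerDeriv n (m + 1) t) t := by
  unfold fejerDeriv
  refine HasDerivAt.fun_sum fun k _ => ?_
  have h1 : HasDerivAt (fun t : ℝ => 2 * Real.pi * k * t + m * (Real.pi / 2))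
      (2 * Real.pi * k) t := by
    simpa using ((hasDerivAt_id t).const_mul (2 * Real.pi * (k : ℝ))).add_const (m * (Real.pi / 2))
  refine (h1.cos.const_mul (sqWeight n k * (2 * Real.pi * k) ^ m)).congr_deriv ?_
  have h2 : 2 * Real.pi * k * t + ((m + 1 : ℕ) : ℝ) * (Real.pi / 2)
      = (2 * Real.pi * k * t + m * (Real.pi / 2)) + Real.pi / 2 := by push_cast; ring
  rw [h2, Real.cos_add_pi_div_two]
  ring

lemma sum_symm_neg {α : Type*} [AddCommMonoid α] (n : ℕ) (f : ℤ → α) :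
    ∑ k ∈ Finset.Icc (-(n : ℤ)) n, f (-k) = ∑ k ∈ Finset.Icc (-(n : ℤ)) n, f k := by
  refine Finset.sum_nbij' (fun k => -k) (fun k => -k) ?_ ?_ ?_ ?_ ?_ <;>
    simp [Finset.mem_Icc] <;> omega

lemma sum_Icc_neg_eq_range {α : Type*} [AddCommMonoid α] (n : ℕ) (f : ℤ → α) :
    ∑ k ∈ Finset.Icc (-(n : ℤ)) n, f k
      = f 0 + ∑ k ∈ Finset.range n, (f ((k : ℤ) + 1) + f (-((k : ℤ) + 1))) := by
  induction n with
  | zero => simp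
  | succ n ih =>
    rw [Nat.cast_add, Nat.cast_one, Finset.Icc_succ_succ, Finset.sum_union (by simp),
      Finset.sum_pair (by omega), ih, Finset.sum_range_succ, add_comm (f (-((n : ℤ) + 1))),
      add_assoc]

lemma fejerDeriv_neg (n m : ℕ) (t : ℝ) : fejerDeriv n m (-t) = (-1) ^ m * fejerDeriv n m t := by
  unfold fejerDeriv
  rw [← sum_symm_neg, Finset.mul_sum]
  refine Finset.sum_congr rfl fun k _ => ?_
  rw [sqWeight_neg]
  have h : 2 * Real.pi * ((-k : ℤ) : ℝ) * -t = 2 * Real.pi * k * t := by push_cast; ring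
  have h' : 2 * Real.pi * ((-k : ℤ) : ℝ) = (-1) * (2 * Real.pi * k) := by push_cast; ring
  rw [h, h', mul_pow]
  ring

lemma fejerDeriv_one_zero (n : ℕ) : fejerDeriv n 1 0 = 0 := by
  have := fejerDeriv_neg n 1 0
  simp at this
  linarith

/-- The exponential sum representation of the derivatives. -/
lemma sum_exp_eq_fejerDeriv (n m : ℕ) (t : ℝ) :
    ∑ k ∈ Finset.Icc (-(n : ℤ)) n, (sqWeight n k : ℂ) * (2 * Real.pi * k * Complex.I) ^ m *
      Complex.exp ((2 * Real.pi * k * t : ℝ) * Complex.I) = (fejerDeriv n m t : ℂ) := by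
  have key : ∀ k : ℤ, (sqWeight n k : ℂ) * (2 * Real.pi * k * Complex.I) ^ m *
      Complex.exp ((2 * Real.pi * k * t : ℝ) * Complex.I)
      = ((sqWeight n k * (2 * Real.pi * k) ^ m : ℝ) : ℂ) *
        Complex.exp ((2 * Real.pi * k * t + m * (Real.pi / 2) : ℝ) * Complex.I) := by
    intro k
    have : Complex.exp ((2 * Real.pi * k * t + m * (Real.pi / 2) : ℝ) * Complex.I)
        = Complex.I ^ m * Complex.exp ((2 * Real.pi * k * t : ℝ) * Complex.I) := by
      have hI : Complex.I ^ m = Complex.exp (m * (Real.pi / 2 * Complex.I)) := by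
        rw [Complex.exp_nat_mul, Complex.exp_pi_div_two_mul_I]
      rw [hI, ← Complex.exp_add]
      congr 1
      push_cast
      ring
    rw [this, mul_pow]
    push_cast
    ring
  apply Complex.ext
  · rw [Complex.ofReal_re, Complex.re_sum]
    refine Finset.sum_congr rfl fun k _ => ?_
    rw [key, Complex.re_ofReal_mul, Complex.exp_ofReal_mul_I_re]
  · rw [Complex.ofReal_im, Complex.im_sum]
    have h : ∀ k : ℤ, ((sqWeight n (-k) : ℂ) * (2 * Real.pi * (-k : ℤ) * Complex.I) ^ m *
      Complex.exp ((2 * Real.pi * (-k : ℤ) * t : ℝ) * Complex.I)).im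
      = -((sqWeight n k : ℂ) * (2 * Real.pi * k * Complex.I) ^ m *
      Complex.exp ((2 * Real.pi * k * t : ℝ) * Complex.I)).im := by
      intro k
      rw [← Complex.conj_im]
      congr 1
      rw [sqWeight_neg]
      simp only [map_mul, map_pow, Complex.conj_ofReal, Complex.conj_I, ← Complex.exp_conj,
        map_ofNat]
      congr 2
      · congr 1; simp
      · push_cast; ring
    have h2 := sum_symm_neg n (fun k : ℤ => ((sqWeight n k : ℂ) * (2 * Real.pi * k * Complex.I) ^ m *
      Complex.exp ((2 * Real.pi * k * t : ℝ) * Complex.I)).im)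
    simp only [h, Finset.sum_neg_distrib] at h2
    linarith

lemma curv_eq_neg (n : ℕ) : curv n = -fejerDeriv n 2 0 := by
  have h0 : deriv (fejer n) = fejerDeriv n 1 := by
    funext t
    rw [← fejerDeriv_zero]
    exact (hasDerivAt_fejerDeriv n 0 t).deriv
  rw [curv, iteratedDeriv_succ, iteratedDeriv_one, h0, (hasDerivAt_fejerDeriv n 1 0).deriv]

lemma curv_eq_sum (n : ℕ) :
    curv n = ∑ k ∈ Finset.Icc (-(n : ℤ)) n, sqWeight n k * (2 * Real.pi * k) ^ 2 := by
  rw [curv_eq_neg, fejerDeriv, ← Finset.sum_neg_distrib]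
  refine Finset.sum_congr rfl fun k _ => ?_
  have : 2 * Real.pi * (k : ℝ) * 0 + ((2 : ℕ) : ℝ) * (Real.pi / 2) = Real.pi := by push_cast; ring
  rw [this, Real.cos_pi]
  ring

lemma sum_range_sq_moment (n : ℕ) (M : ℝ) :
    ∑ k ∈ Finset.range n, (M - ((k : ℝ) + 1)) * ((k : ℝ) + 1) ^ 2
      = M * (n * (n + 1) * (2 * n + 1) / 6) - (n * (n + 1) / 2) ^ 2 := by
  induction n with
  | zero => simp
  | succ n ih => rw [Finset.sum_range_succ, ih]; push_cast; ring

lemma sum_range_four_moment (n : ℕ) (M : ℝ) :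
    ∑ k ∈ Finset.range n, (M - ((k : ℝ) + 1)) * ((k : ℝ) + 1) ^ 4
      = M * (n * (n + 1) * (2 * n + 1) * (3 * n ^ 2 + 3 * n - 1) / 30)
        - n ^ 2 * (n + 1) ^ 2 * (2 * n ^ 2 + 2 * n - 1) / 12 := by
  induction n with
  | zero => simp
  | succ n ih => rw [Finset.sum_range_succ, ih]; push_cast; ring

lemma sum_sqWeight_mul_pow (n m : ℕ) (hm : m ≠ 0) (he : Even m) :
    ∑ k ∈ Finset.Icc (-(n : ℤ)) n, sqWeight n k * (2 * Real.pi * k) ^ m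
      = 2 * (2 * Real.pi) ^ m / ((n : ℝ) + 1) ^ 2 *
        ∑ k ∈ Finset.range n, (((n : ℝ) + 1) - ((k : ℝ) + 1)) * ((k : ℝ) + 1) ^ m := by
  rw [sum_Icc_neg_eq_range, Finset.mul_sum]
  simp only [Int.cast_zero, mul_zero, zero_pow hm, zero_add]
  refine Finset.sum_congr rfl fun k _ => ?_
  have hM : (n : ℝ) + 1 ≠ 0 := by positivity
  have hk : |((k : ℝ) + 1)| = (k : ℝ) + 1 := abs_of_nonneg (by positivity)
  have h3 : 2 * Real.pi * ((-((k : ℤ) + 1) : ℤ) : ℝ) = -(2 * Real.pi * ((k : ℝ) + 1)) := by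
    push_cast; ring
  rw [sqWeight_neg, h3, he.neg_pow]
  unfold sqWeight
  push_cast
  rw [hk, mul_pow]
  field_simp
  ring

lemma curv_eq (n : ℕ) : curv n = 2 / 3 * Real.pi ^ 2 * (((n : ℝ) + 1) ^ 2 - 1) := by
  rw [curv_eq_sum, sum_sqWeight_mul_pow n 2 (by norm_num) (by decide), sum_range_sq_moment]
  have hM : (n : ℝ) + 1 ≠ 0 := by positivity
  field_simp
  ring

lemma curv_pos {n : ℕ} (hn : 1 ≤ n) : 0 < curv n := by
  have : (1 : ℝ) ≤ n := by exact_mod_cast hn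
  rw [curv_eq]
  have h : (0 : ℝ) < ((n : ℝ) + 1) ^ 2 - 1 := by nlinarith
  positivity

lemma sum_sqWeight_four_le {n : ℕ} :
    ∑ k ∈ Finset.Icc (-(n : ℤ)) n, sqWeight n k * (2 * Real.pi * k) ^ 4
      ≤ 12 / 5 * curv n ^ 2 := by
  rw [sum_sqWeight_mul_pow n 4 (by norm_num) (by decide), sum_range_four_moment, curv_eq]
  have hM : (n : ℝ) + 1 ≠ 0 := by positivity
  have : 2 * (2 * Real.pi) ^ 4 / ((n : ℝ) + 1) ^ 2 *
      (((n : ℝ) + 1) * (n * (n + 1) * (2 * n + 1) * (3 * n ^ 2 + 3 * n - 1) / 30)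
        - n ^ 2 * (n + 1) ^ 2 * (2 * n ^ 2 + 2 * n - 1) / 12)
      = 12 / 5 * (2 / 3 * Real.pi ^ 2 * (((n : ℝ) + 1) ^ 2 - 1)) ^ 2
        - 8 / 15 * Real.pi ^ 4 * (n * (n + 2)) := by
    field_simp
    ring
  rw [this]
  have : 0 ≤ 8 / 15 * Real.pi ^ 4 * ((n : ℝ) * (n + 2)) := by positivity
  linarith

lemma abs_fejerDeriv_two_le (n : ℕ) (t : ℝ) : |fejerDeriv n 2 t| ≤ curv n := by
  rw [curv_eq_sum, fejerDeriv]
  refine (Finset.abs_sum_le_sum_abs _ _).trans (Finset.sum_le_sum fun k hk => ?_)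
  have h0 : 0 ≤ sqWeight n k * (2 * Real.pi * k) ^ 2 :=
    mul_nonneg (sqWeight_nonneg hk) (by positivity)
  rw [abs_mul, abs_of_nonneg h0]
  exact mul_le_of_le_one_right h0 (Real.abs_cos_le_one _)

lemma abs_fejerDeriv_one_le (n : ℕ) (t : ℝ) : |fejerDeriv n 1 t| ≤ curv n * |t| := by
  have h := convex_univ.norm_image_sub_le_of_norm_hasDerivWithin_le (x := (0 : ℝ)) (y := t)
    (fun x _ => (hasDerivAt_fejerDeriv n 1 x).hasDerivWithinAt)
    (fun x _ => abs_fejerDeriv_two_le n x) (Set.mem_univ _) (Set.mem_univ _)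
  simpa [fejerDeriv_one_zero] using h

lemma neg_fejerDeriv_two_ge (n : ℕ) (t : ℝ) :
    curv n - 6 / 5 * curv n ^ 2 * t ^ 2 ≤ -fejerDeriv n 2 t := by
  have h4 := sum_sqWeight_four_le (n := n)
  have h : curv n - t ^ 2 / 2 * ∑ k ∈ Finset.Icc (-(n : ℤ)) n, sqWeight n k * (2 * Real.pi * k) ^ 4
      ≤ -fejerDeriv n 2 t := by
    rw [curv_eq_sum, fejerDeriv, Finset.mul_sum, ← Finset.sum_sub_distrib,
      ← Finset.sum_neg_distrib]
    refine Finset.sum_le_sum fun k hk => ?_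
    have h0 : 0 ≤ sqWeight n k * (2 * Real.pi * k) ^ 2 :=
      mul_nonneg (sqWeight_nonneg hk) (by positivity)
    have h1 : 2 * Real.pi * (k : ℝ) * t + ((2 : ℕ) : ℝ) * (Real.pi / 2)
        = 2 * Real.pi * k * t + Real.pi := by push_cast; ring
    rw [h1, Real.cos_add_pi]
    have h2 := Real.one_sub_sq_div_two_le_cos (x := 2 * Real.pi * k * t)
    nlinarith [mul_le_mul_of_nonneg_left h2 h0]
  nlinarith [sq_nonneg t]

/-! ### Decay of the kernel away from the integers -/

lemma sin_pi_mul_dirichlet (n : ℕ) (t : ℝ) :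
    Real.sin (Real.pi * t) * ∑ k ∈ Finset.Icc (-(n : ℤ)) n, Real.cos (2 * Real.pi * k * t)
      = Real.sin ((2 * n + 1) * (Real.pi * t)) := by
  rw [sum_Icc_neg_eq_range]
  induction n with
  | zero => simp
  | succ n ih =>
    rw [Finset.sum_range_succ, ← add_assoc, mul_add, ih]
    have h1 : 2 * Real.pi * ((-((n : ℤ) + 1) : ℤ) : ℝ) * t
        = -(2 * Real.pi * (((n : ℤ) + 1 : ℤ) : ℝ) * t) := by push_cast; ring
    rw [h1, Real.cos_neg]
    have h2 : 2 * Real.pi * (((n : ℤ) + 1 : ℤ) : ℝ) * t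
        = (2 * n + 1) * (Real.pi * t) + Real.pi * t := by push_cast; ring
    have h3 : (2 * ((n + 1 : ℕ) : ℝ) + 1) * (Real.pi * t)
        = ((2 * n + 1) * (Real.pi * t) + Real.pi * t) + Real.pi * t := by push_cast; ring
    rw [h2, h3, Real.sin_add _ (Real.pi * t), Real.sin_add _ (Real.pi * t),
      Real.cos_add _ (Real.pi * t)]
    have := Real.sin_sq_add_cos_sq (Real.pi * t)
    linear_combination (-Real.sin ((2 * n + 1) * (Real.pi * t))) * this

lemma sin_sq_mul_fejer_sum (n : ℕ) (t : ℝ) :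
    Real.sin (Real.pi * t) ^ 2 * ∑ k ∈ Finset.Icc (-(n : ℤ)) n,
      (((n : ℝ) + 1) - |(k : ℝ)|) * Real.cos (2 * Real.pi * k * t)
      = Real.sin (((n : ℝ) + 1) * (Real.pi * t)) ^ 2 := by
  induction n with
  | zero => simp
  | succ n ih =>
    have hstep : ∑ k ∈ Finset.Icc (-((n + 1 : ℕ) : ℤ)) ((n + 1 : ℕ) : ℤ),
          ((((n + 1 : ℕ) : ℝ) + 1) - |(k : ℝ)|) * Real.cos (2 * Real.pi * k * t)
        = ∑ k ∈ Finset.Icc (-(n : ℤ)) n,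
            (((n : ℝ) + 1) - |(k : ℝ)|) * Real.cos (2 * Real.pi * k * t)
          + ∑ k ∈ Finset.Icc (-((n + 1 : ℕ) : ℤ)) ((n + 1 : ℕ) : ℤ),
            Real.cos (2 * Real.pi * k * t) := by
      have hsub : Finset.Icc (-(n : ℤ)) n ⊆ Finset.Icc (-((n + 1 : ℕ) : ℤ)) ((n + 1 : ℕ) : ℤ) :=
        Finset.Icc_subset_Icc (by push_cast; omega) (by push_cast; omega)
      rw [Finset.sum_subset hsub, ← Finset.sum_add_distrib]
      · refine Finset.sum_congr rfl fun k _ => ?_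
        push_cast; ring
      · intro k hk hk'
        rw [Finset.mem_Icc] at hk hk'
        have hk1 : |k| = (n : ℤ) + 1 := by
          push_cast at hk
          rcases abs_cases k with h | h <;> omega
        have : |(k : ℝ)| = (n : ℝ) + 1 := by exact_mod_cast hk1
        rw [this]; ring
    rw [hstep, mul_add, ih, pow_two (Real.sin (Real.pi * t)), mul_assoc, sin_pi_mul_dirichlet]
    have h1 : (2 * ((n + 1 : ℕ) : ℝ) + 1) * (Real.pi * t)
        = ((n : ℝ) + 1) * (Real.pi * t) + (((n : ℝ) + 1) * (Real.pi * t) + Real.pi * t) := by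
      push_cast; ring
    have h2 : (((n + 1 : ℕ) : ℝ) + 1) * (Real.pi * t)
        = ((n : ℝ) + 1) * (Real.pi * t) + Real.pi * t := by push_cast; ring
    rw [h1, h2, Real.sin_add _ (((n : ℝ) + 1) * (Real.pi * t) + Real.pi * t),
      Real.sin_add _ (Real.pi * t), Real.cos_add _ (Real.pi * t)]
    have e1 := Real.sin_sq_add_cos_sq (Real.pi * t)
    linear_combination (-Real.sin (((n : ℝ) + 1) * (Real.pi * t)) ^ 2) * e1

lemma fejer_closed_form (n : ℕ) {t : ℝ} (ht : Real.sin (Real.pi * t) ≠ 0) :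
    fejerDeriv n 0 t = (((n : ℝ) + 1) ^ 2)⁻¹ *
      ((1 - Real.cos (2 * Real.pi * ((n : ℝ) + 1) * t)) / 2 * (Real.sin (Real.pi * t) ^ 2)⁻¹) := by
  have hM : (n : ℝ) + 1 ≠ 0 := by positivity
  have h0 : fejerDeriv n 0 t = (((n : ℝ) + 1) ^ 2)⁻¹ * ∑ k ∈ Finset.Icc (-(n : ℤ)) n,
      (((n : ℝ) + 1) - |(k : ℝ)|) * Real.cos (2 * Real.pi * k * t) := by
    rw [fejerDeriv, Finset.mul_sum]
    refine Finset.sum_congr rfl fun k _ => ?_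
    unfold sqWeight
    simp only [Nat.cast_zero, zero_mul, add_zero, pow_zero, mul_one]
    field_simp
  have h1 := sin_sq_mul_fejer_sum n t
  have h2 : (1 - Real.cos (2 * Real.pi * ((n : ℝ) + 1) * t)) / 2
      = Real.sin (((n : ℝ) + 1) * (Real.pi * t)) ^ 2 := by
    rw [Real.sin_sq_eq_half_sub]
    have : 2 * Real.pi * ((n : ℝ) + 1) * t = 2 * (((n : ℝ) + 1) * (Real.pi * t)) := by ring
    rw [this]; ring
  rw [h0, h2, ← h1, mul_comm (Real.sin (Real.pi * t) ^ 2), mul_assoc _ (Real.sin _ ^ 2),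
    mul_inv_cancel₀ (pow_ne_zero 2 ht), mul_one]

lemma hasDerivAt_numerators (w t : ℝ) :
    HasDerivAt (fun t => (1 - Real.cos (2 * w * t)) / 2) (w * Real.sin (2 * w * t)) t ∧
    HasDerivAt (fun t => w * Real.sin (2 * w * t)) (2 * w ^ 2 * Real.cos (2 * w * t)) t ∧
    HasDerivAt (fun t => 2 * w ^ 2 * Real.cos (2 * w * t))
      (-(4 * w ^ 3 * Real.sin (2 * w * t))) t := by
  have h : HasDerivAt (fun t : ℝ => 2 * w * t) (2 * w) t := by
    simpa using (hasDerivAt_id t).const_mul (2 * w)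
  refine ⟨((h.cos.const_sub 1).div_const 2).congr_deriv (by ring),
    (h.sin.const_mul w).congr_deriv (by ring),
    (h.cos.const_mul (2 * w ^ 2)).congr_deriv (by ring)⟩

lemma hasDerivAt_inv_sin_powers {t : ℝ} (ht : Real.sin (Real.pi * t) ≠ 0) :
    HasDerivAt (fun t => (Real.sin (Real.pi * t) ^ 2)⁻¹)
      (-(2 * Real.pi * Real.cos (Real.pi * t) * (Real.sin (Real.pi * t) ^ 3)⁻¹)) t ∧
    HasDerivAt (fun t => -(2 * Real.pi * Real.cos (Real.pi * t) * (Real.sin (Real.pi * t) ^ 3)⁻¹))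
      (Real.pi ^ 2 * ((6 - 4 * Real.sin (Real.pi * t) ^ 2) * (Real.sin (Real.pi * t) ^ 4)⁻¹)) t ∧
    HasDerivAt
      (fun t => Real.pi ^ 2 *
        ((6 - 4 * Real.sin (Real.pi * t) ^ 2) * (Real.sin (Real.pi * t) ^ 4)⁻¹))
      (-(Real.pi ^ 3 * Real.cos (Real.pi * t) *
        ((24 - 8 * Real.sin (Real.pi * t) ^ 2) * (Real.sin (Real.pi * t) ^ 5)⁻¹))) t := by
  have h : HasDerivAt (fun t : ℝ => Real.pi * t) Real.pi t := by
    simpa using (hasDerivAt_id t).const_mul Real.pi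
  have hi : ∀ m : ℕ, HasDerivAt (fun t => (Real.sin (Real.pi * t) ^ m)⁻¹)
      (-(m * Real.pi * Real.cos (Real.pi * t) * (Real.sin (Real.pi * t) ^ (m + 1))⁻¹)) t := by
    intro m
    refine ((h.sin.fun_pow m).fun_inv (pow_ne_zero m ht)).congr_deriv ?_
    rcases m with _ | m
    · simp
    · simp only [Nat.add_sub_cancel]
      field_simp
      ring
  have e1 := Real.sin_sq_add_cos_sq (Real.pi * t)
  refine ⟨(hi 2).congr_deriv (by norm_num), ?_, ?_⟩
  · refine (((h.cos.const_mul (2 * Real.pi)).fun_mul (hi 3)).fun_neg).congr_deriv ?_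
    push_cast
    field_simp
    linear_combination 6 * e1
  · refine (((((h.sin.fun_pow 2).const_mul 4).const_sub 6).fun_mul (hi 4)).const_mul
      (Real.pi ^ 2)).congr_deriv ?_
    push_cast
    field_simp
    ring

lemma eventually_sin_ne_zero {t : ℝ} (ht : Real.sin (Real.pi * t) ≠ 0) :
    ∀ᶠ x in nhds t, Real.sin (Real.pi * x) ≠ 0 :=
  (by fun_prop : Continuous fun x : ℝ => Real.sin (Real.pi * x)).continuousAt.eventually_ne ht

lemma fejerDeriv_succ_eq {n m : ℕ} {f f' : ℝ → ℝ}
    (h : ∀ t, Real.sin (Real.pi * t) ≠ 0 → fejerDeriv n m t = f t)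
    (hf : ∀ t, Real.sin (Real.pi * t) ≠ 0 → HasDerivAt f (f' t) t) :
    ∀ t, Real.sin (Real.pi * t) ≠ 0 → fejerDeriv n (m + 1) t = f' t := fun t ht =>
  (hasDerivAt_fejerDeriv n m t).unique
    ((hf t ht).congr_of_eventuallyEq ((eventually_sin_ne_zero ht).mono fun x hx => h x hx))

/-- Pointwise decay of the kernel and of its first three derivatives in terms of
`y = (n + 1) |sin (π t)|`. -/
lemma fejerDeriv_decay (n : ℕ) {t y : ℝ} (hy0 : 0 < y)
    (hy : y = ((n : ℝ) + 1) * |Real.sin (Real.pi * t)|) :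
    |fejerDeriv n 0 t| ≤ 1 / y ^ 2 ∧
    |fejerDeriv n 1 t| ≤ (Real.pi * ((n : ℝ) + 1)) * (1 / y ^ 2 + 2 / y ^ 3) ∧
    |fejerDeriv n 2 t| ≤ (Real.pi * ((n : ℝ) + 1)) ^ 2 * (2 / y ^ 2 + 4 / y ^ 3 + 6 / y ^ 4) ∧
    |fejerDeriv n 3 t| ≤ (Real.pi * ((n : ℝ) + 1)) ^ 3 *
      (4 / y ^ 2 + 12 / y ^ 3 + 18 / y ^ 4 + 24 / y ^ 5) := by
  have hM : (0 : ℝ) < (n : ℝ) + 1 := by positivity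
  set M : ℝ := (n : ℝ) + 1 with hMdef
  have ht : Real.sin (Real.pi * t) ≠ 0 := by
    intro h; rw [h] at hy; simp at hy; linarith
  set w : ℝ := Real.pi * M with hw
  have hw0 : 0 < w := by positivity
  let p0 : ℝ → ℝ := fun t => (1 - Real.cos (2 * w * t)) / 2
  let p1 : ℝ → ℝ := fun t => w * Real.sin (2 * w * t)
  let p2 : ℝ → ℝ := fun t => 2 * w ^ 2 * Real.cos (2 * w * t)
  let p3 : ℝ → ℝ := fun t => -(4 * w ^ 3 * Real.sin (2 * w * t))
  let g0 : ℝ → ℝ := fun t => (Real.sin (Real.pi * t) ^ 2)⁻¹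
  let g1 : ℝ → ℝ := fun t =>
    -(2 * Real.pi * Real.cos (Real.pi * t) * (Real.sin (Real.pi * t) ^ 3)⁻¹)
  let g2 : ℝ → ℝ := fun t =>
    Real.pi ^ 2 * ((6 - 4 * Real.sin (Real.pi * t) ^ 2) * (Real.sin (Real.pi * t) ^ 4)⁻¹)
  let g3 : ℝ → ℝ := fun t => -(Real.pi ^ 3 * Real.cos (Real.pi * t) *
    ((24 - 8 * Real.sin (Real.pi * t) ^ 2) * (Real.sin (Real.pi * t) ^ 5)⁻¹))
  have P0 : ∀ t, HasDerivAt p0 (p1 t) t := fun t => (hasDerivAt_numerators w t).1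
  have P1 : ∀ t, HasDerivAt p1 (p2 t) t := fun t => (hasDerivAt_numerators w t).2.1
  have P2 : ∀ t, HasDerivAt p2 (p3 t) t := fun t => (hasDerivAt_numerators w t).2.2
  have G0 : ∀ t, Real.sin (Real.pi * t) ≠ 0 → HasDerivAt g0 (g1 t) t :=
    fun t ht => (hasDerivAt_inv_sin_powers ht).1
  have G1 : ∀ t, Real.sin (Real.pi * t) ≠ 0 → HasDerivAt g1 (g2 t) t :=
    fun t ht => (hasDerivAt_inv_sin_powers ht).2.1
  have G2 : ∀ t, Real.sin (Real.pi * t) ≠ 0 → HasDerivAt g2 (g3 t) t :=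
    fun t ht => (hasDerivAt_inv_sin_powers ht).2.2
  have E0 : ∀ t, Real.sin (Real.pi * t) ≠ 0 →
      fejerDeriv n 0 t = (M ^ 2)⁻¹ * (p0 t * g0 t) := by
    intro t ht
    rw [fejer_closed_form n ht]
    simp only [p0, g0, hw, hMdef, mul_assoc]
  have E1 : ∀ t, Real.sin (Real.pi * t) ≠ 0 →
      fejerDeriv n 1 t = (M ^ 2)⁻¹ * (p1 t * g0 t + p0 t * g1 t) :=
    fejerDeriv_succ_eq E0 fun t ht => ((P0 t).fun_mul (G0 t ht)).const_mul _
  have E2 : ∀ t, Real.sin (Real.pi * t) ≠ 0 →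
      fejerDeriv n 2 t = (M ^ 2)⁻¹ * (p2 t * g0 t + p1 t * g1 t + (p1 t * g1 t + p0 t * g2 t)) :=
    fejerDeriv_succ_eq E1 fun t ht =>
      (((P1 t).fun_mul (G0 t ht)).fun_add ((P0 t).fun_mul (G1 t ht))).const_mul _
  have E3 : ∀ t, Real.sin (Real.pi * t) ≠ 0 →
      fejerDeriv n 3 t = (M ^ 2)⁻¹ * (p3 t * g0 t + p2 t * g1 t + (p2 t * g1 t + p1 t * g2 t)
        + (p2 t * g1 t + p1 t * g2 t + (p1 t * g2 t + p0 t * g3 t))) :=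
    fejerDeriv_succ_eq E2 fun t ht =>
      ((((P2 t).fun_mul (G0 t ht)).fun_add ((P1 t).fun_mul (G1 t ht))).fun_add
        (((P1 t).fun_mul (G1 t ht)).fun_add ((P0 t).fun_mul (G2 t ht)))).const_mul _
  have hs0 : 0 < |Real.sin (Real.pi * t)| := abs_pos.mpr ht
  set s : ℝ := |Real.sin (Real.pi * t)| with hs
  have hs2 : Real.sin (Real.pi * t) ^ 2 = s ^ 2 := (sq_abs _).symm
  have hs1 : s ^ 2 ≤ 1 := by rw [← hs2]; exact Real.sin_sq_le_one _
  have hp := Real.pi_pos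
  have b0 : |p0 t| ≤ 1 := by
    have h1 := Real.neg_one_le_cos (2 * w * t)
    have h2 := Real.cos_le_one (2 * w * t)
    rw [abs_le]; constructor <;> simp only [p0] <;> linarith
  have b1 : |p1 t| ≤ w := by
    simp only [p1, abs_mul, abs_of_pos hw0]
    exact mul_le_of_le_one_right hw0.le (Real.abs_sin_le_one _)
  have b2 : |p2 t| ≤ 2 * w ^ 2 := by
    have h : 0 ≤ 2 * w ^ 2 := by positivity
    simp only [p2]
    rw [abs_mul, abs_of_nonneg h]
    exact mul_le_of_le_one_right h (Real.abs_cos_le_one _)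
  have b3 : |p3 t| ≤ 4 * w ^ 3 := by
    have h : 0 ≤ 4 * w ^ 3 := by positivity
    simp only [p3]
    rw [abs_neg, abs_mul, abs_of_nonneg h]
    exact mul_le_of_le_one_right h (Real.abs_sin_le_one _)
  have hc := Real.abs_cos_le_one (Real.pi * t)
  have c0 : |g0 t| ≤ 1 / s ^ 2 := by
    simp only [g0]
    rw [hs2, abs_of_nonneg (by positivity), one_div]
  have c1 : |g1 t| ≤ 2 * Real.pi / s ^ 3 := by
    simp only [g1]
    rw [abs_neg, abs_mul, abs_mul, abs_inv, abs_pow, ← hs, abs_of_pos (by positivity),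
      div_eq_mul_inv]
    exact mul_le_mul_of_nonneg_right (mul_le_of_le_one_right (by positivity) hc) (by positivity)
  have c2 : |g2 t| ≤ 6 * Real.pi ^ 2 / s ^ 4 := by
    simp only [g2]
    rw [abs_mul, abs_mul, abs_inv, abs_pow _ 4, ← hs, hs2, abs_of_pos (by positivity : 0 < Real.pi ^ 2),
      abs_of_nonneg (by linarith : 0 ≤ 6 - 4 * s ^ 2)]
    have : (6 - 4 * s ^ 2) * (s ^ 4)⁻¹ ≤ 6 * (s ^ 4)⁻¹ :=
      mul_le_mul_of_nonneg_right (by nlinarith [sq_nonneg s]) (by positivity)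
    calc _ ≤ Real.pi ^ 2 * (6 * (s ^ 4)⁻¹) := mul_le_mul_of_nonneg_left this (by positivity)
      _ = _ := by ring
  have c3 : |g3 t| ≤ 24 * Real.pi ^ 3 / s ^ 5 := by
    simp only [g3]
    rw [abs_neg, abs_mul, abs_mul, abs_mul, abs_inv, abs_pow _ 5, ← hs, hs2,
      abs_of_pos (by positivity : 0 < Real.pi ^ 3),
      abs_of_nonneg (by linarith : 0 ≤ 24 - 8 * s ^ 2)]
    have : (24 - 8 * s ^ 2) * (s ^ 5)⁻¹ ≤ 24 * (s ^ 5)⁻¹ :=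
      mul_le_mul_of_nonneg_right (by nlinarith [sq_nonneg s]) (by positivity)
    calc _ ≤ Real.pi ^ 3 * (24 * (s ^ 5)⁻¹) :=
          mul_le_mul (mul_le_of_le_one_right (by positivity) hc) this
            (mul_nonneg (by linarith) (by positivity)) (by positivity)
      _ = _ := by ring
  have mm : ∀ {a b A B : ℝ}, |a| ≤ A → |b| ≤ B → |a * b| ≤ A * B := by
    intro a b A B ha hb
    rw [abs_mul]
    exact mul_le_mul ha hb (abs_nonneg _) ((abs_nonneg _).trans ha)
  have hfin : ∀ {z B : ℝ}, |z| ≤ B → |(M ^ 2)⁻¹ * z| ≤ (M ^ 2)⁻¹ * B := by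
    intro z B hz
    rw [abs_mul, abs_of_pos (by positivity : 0 < (M ^ 2)⁻¹)]
    exact mul_le_mul_of_nonneg_left hz (by positivity)
  have aa : ∀ {a b A B : ℝ}, |a| ≤ A → |b| ≤ B → |a + b| ≤ A + B := fun ha hb =>
    (abs_add_le _ _).trans (add_le_add ha hb)
  refine ⟨?_, ?_, ?_, ?_⟩
  · rw [E0 t ht]
    refine (hfin (mm b0 c0)).trans (le_of_eq ?_)
    rw [hy]; field_simp
  · rw [E1 t ht]
    refine (hfin (aa (mm b1 c0) (mm b0 c1))).trans (le_of_eq ?_)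
    rw [hy, hw]; field_simp
  · rw [E2 t ht]
    refine (hfin (aa (aa (mm b2 c0) (mm b1 c1)) (aa (mm b1 c1) (mm b0 c2)))).trans (le_of_eq ?_)
    rw [hy, hw]; field_simp; ring
  · rw [E3 t ht]
    refine (hfin (aa (aa (aa (mm b3 c0) (mm b2 c1)) (aa (mm b2 c1) (mm b1 c2)))
      (aa (aa (mm b2 c1) (mm b1 c2)) (aa (mm b1 c2) (mm b0 c3))))).trans (le_of_eq ?_)
    rw [hy, hw]; field_simp; ring

/-! ### Gradient and Hessian of the loss -/

/-- The `m`-th derivative at `x` of the kernel smoothing of the error measure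
`∑ a_l δ_{τ_l} - ∑ a*_l δ_{τ*_l}`. -/
noncomputable def smoothedError (n m : ℕ) {r : ℕ} (θs θ : Param r) (x : ℝ) : ℂ :=
  ∑ l, θ.1 l * (fejerDeriv n m (x - θ.2 l) : ℂ) -
    ∑ l, θs.1 l * (fejerDeriv n m (x - θs.2 l) : ℂ)

lemma hasDerivAt_half_norm_sq {r : ℝ → ℂ} {r' : ℂ} {t : ℝ} (h : HasDerivAt r r' t) :
    HasDerivAt (fun t => (1 / 2) * ‖r t‖ ^ 2) ((starRingEnd ℂ r' * r t).re) t := by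
  have h1 := (h.norm_sq).const_mul (1 / 2 : ℝ)
  refine h1.congr_deriv ?_
  rw [Complex.inner]
  simp

lemma hasDerivAt_loss_comp {n r : ℕ} (θs : Param r) {p : ℝ → Param r} {q : ℤ → ℂ} {t : ℝ}
    (h : ∀ k : ℤ, HasDerivAt (fun t => obs n (p t) k) (q k) t) :
    HasDerivAt (fun t => loss n θs (p t))
      (∑ k ∈ Finset.Icc (-(n : ℤ)) n,
        starRingEnd ℂ (q k) * (obs n (p t) k - obs n θs k)).re t := by
  have h1 : HasDerivAt (fun t => ∑ k ∈ Finset.Icc (-(n : ℤ)) n,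
      (1 / 2) * ‖obs n (p t) k - obs n θs k‖ ^ 2)
      (∑ k ∈ Finset.Icc (-(n : ℤ)) n,
        (starRingEnd ℂ (q k) * (obs n (p t) k - obs n θs k)).re) t :=
    HasDerivAt.fun_sum fun k _ => hasDerivAt_half_norm_sq ((h k).sub_const _)
  rw [Complex.re_sum]
  refine h1.congr_of_eventuallyEq (Filter.Eventually.of_forall fun x => ?_)
  simp [loss, Finset.mul_sum]

/-- The test functions dual to the smoothed error. -/
lemma sum_conj_mul_obs_sub (n m : ℕ) {r : ℕ} (θs θ : Param r) (x : ℝ) :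
    ∑ k ∈ Finset.Icc (-(n : ℤ)) n,
      (weight n k : ℂ) * ((2 * Real.pi * k * Complex.I) ^ m *
        Complex.exp ((2 * Real.pi * k * x : ℝ) * Complex.I)) * (obs n θ k - obs n θs k)
      = smoothedError n m θs θ x := by
  have key : ∀ θ : Param r, ∑ k ∈ Finset.Icc (-(n : ℤ)) n,
      (weight n k : ℂ) * ((2 * Real.pi * k * Complex.I) ^ m *
        Complex.exp ((2 * Real.pi * k * x : ℝ) * Complex.I)) * obs n θ k
      = ∑ l, θ.1 l * (fejerDeriv n m (x - θ.2 l) : ℂ) := by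
    intro θ
    simp only [obs, Finset.mul_sum, ← sum_exp_eq_fejerDeriv]
    rw [Finset.sum_comm]
    refine Finset.sum_congr rfl fun l _ => Finset.sum_congr rfl fun k hk => ?_
    have h1 : Complex.exp ((2 * Real.pi * k * (x - θ.2 l) : ℝ) * Complex.I)
        = Complex.exp ((2 * Real.pi * k * x : ℝ) * Complex.I) *
          Complex.exp (-(2 * Real.pi * k * θ.2 l : ℝ) * Complex.I) := by
      rw [← Complex.exp_add]
      congr 1
      push_cast
      ring
    rw [h1, ← weight_mul_self hk]
    push_cast
    ring
  simp only [mul_sub, Finset.sum_sub_distrib, key, smoothedError]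

lemma conj_exp_mul_I (x : ℝ) :
    starRingEnd ℂ (Complex.exp (-(x : ℂ) * Complex.I)) = Complex.exp ((x : ℂ) * Complex.I) := by
  rw [← Complex.exp_conj]
  simp

lemma hasDerivAt_obs_amp (n : ℕ) {r : ℕ} (θ : Param r) (i : Fin r) (c : ℂ) (k : ℤ) :
    HasDerivAt (fun x : ℝ => obs n (Function.update θ.1 i (θ.1 i + x * c), θ.2) k)
      ((weight n k : ℂ) *
        (c * Complex.exp (-(2 * Real.pi * k * θ.2 i : ℝ) * Complex.I))) 0 := by
  unfold obs
  refine HasDerivAt.const_mul _ ?_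
  have h : ∀ l ∈ Finset.univ, HasDerivAt (fun x : ℝ => Function.update θ.1 i (θ.1 i + x * c) l *
      Complex.exp (-(2 * Real.pi * k * θ.2 l : ℝ) * Complex.I))
      (if l = i then c * Complex.exp (-(2 * Real.pi * k * θ.2 i : ℝ) * Complex.I) else 0) 0 := by
    intro l _
    by_cases hl : l = i
    · subst hl
      simp only [Function.update_self, if_true]
      have h1 : HasDerivAt (fun x : ℝ => θ.1 l + (x : ℂ) * c) c 0 := by
        simpa using (((hasDerivAt_id (0 : ℝ)).ofReal_comp).mul_const c).const_add (θ.1 l)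
      exact h1.mul_const _
    · simp only [Function.update_of_ne hl, if_neg hl]
      exact hasDerivAt_const _ _
  refine (HasDerivAt.fun_sum h).congr_deriv ?_
  simp

lemma gradAmp_loss (n : ℕ) {r : ℕ} (θs θ : Param r) (i : Fin r) :
    gradAmp (loss n θs) θ i = smoothedError n 0 θs θ (θ.2 i) := by
  have h := fun c : ℂ => (hasDerivAt_loss_comp θs (hasDerivAt_obs_amp n θ i c)).deriv
  have hval : ∀ c : ℂ, (∑ k ∈ Finset.Icc (-(n : ℤ)) n,
      starRingEnd ℂ ((weight n k : ℂ) *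
        (c * Complex.exp (-(2 * Real.pi * k * θ.2 i : ℝ) * Complex.I))) *
        (obs n (Function.update θ.1 i (θ.1 i + ((0 : ℝ) : ℂ) * c), θ.2) k - obs n θs k))
      = starRingEnd ℂ c * smoothedError n 0 θs θ (θ.2 i) := by
    intro c
    rw [← sum_conj_mul_obs_sub, Finset.mul_sum]
    refine Finset.sum_congr rfl fun k _ => ?_
    rw [map_mul, map_mul, conj_exp_mul_I, Complex.conj_ofReal]
    simp only [Complex.ofReal_zero, zero_mul, add_zero, Function.update_eq_self, pow_zero, one_mul]
    ring
  have h1 := h 1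
  have h2 := h Complex.I
  rw [hval] at h1 h2
  simp only [mul_one] at h1
  rw [gradAmp, h1, h2]
  apply Complex.ext <;> simp

lemma hasDerivAt_obs_loc (n : ℕ) {r : ℕ} (θ : Param r) (i : Fin r) (k : ℤ) :
    HasDerivAt (fun t : ℝ => obs n (θ.1, Function.update θ.2 i t) k)
      ((weight n k : ℂ) * (θ.1 i * (-(2 * Real.pi * k * Complex.I) *
        Complex.exp (-(2 * Real.pi * k * θ.2 i : ℝ) * Complex.I)))) (θ.2 i) := by
  unfold obs
  refine HasDerivAt.const_mul _ ?_
  have h : ∀ l ∈ Finset.univ, HasDerivAt (fun t : ℝ => θ.1 l *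
      Complex.exp (-(2 * Real.pi * k * Function.update θ.2 i t l : ℝ) * Complex.I))
      (if l = i then θ.1 i * (-(2 * Real.pi * k * Complex.I) *
        Complex.exp (-(2 * Real.pi * k * θ.2 i : ℝ) * Complex.I)) else 0) (θ.2 i) := by
    intro l _
    by_cases hl : l = i
    · subst hl
      simp only [Function.update_self, if_true]
      have h1 : HasDerivAt (fun t : ℝ => -((2 * Real.pi * k * t : ℝ) : ℂ) * Complex.I)
          (-(2 * Real.pi * k * Complex.I)) (θ.2 l) := by
        have h0 : HasDerivAt (fun t : ℝ => 2 * Real.pi * k * t) (2 * Real.pi * k) (θ.2 l) := by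
          simpa using (hasDerivAt_id (θ.2 l)).const_mul (2 * Real.pi * (k : ℝ))
        refine (h0.ofReal_comp.fun_neg.mul_const Complex.I).congr_deriv ?_
        push_cast
        ring
      refine (h1.cexp.const_mul (θ.1 l)).congr_deriv ?_
      ring
    · simp only [Function.update_of_ne hl, if_neg hl]
      exact hasDerivAt_const _ _
  refine (HasDerivAt.fun_sum h).congr_deriv ?_
  simp

lemma gradLoc_loss (n : ℕ) {r : ℕ} (θs θ : Param r) (i : Fin r) :
    gradLoc (loss n θs) θ i
      = (starRingEnd ℂ (θ.1 i) * smoothedError n 1 θs θ (θ.2 i)).re := by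
  rw [gradLoc, (hasDerivAt_loss_comp θs (hasDerivAt_obs_loc n θ i)).deriv]
  congr 1
  rw [← sum_conj_mul_obs_sub, Finset.mul_sum]
  refine Finset.sum_congr rfl fun k _ => ?_
  simp only [map_mul, map_neg, conj_exp_mul_I, Complex.conj_ofReal, Function.update_eq_self,
    Complex.conj_I, pow_one, map_ofNat, map_intCast]
  ring

lemma hasDerivAt_smoothedError_loc (n m : ℕ) {r : ℕ} (θs θ : Param r) (i j : Fin r) :
    HasDerivAt (fun t : ℝ => smoothedError n m θs (θ.1, Function.update θ.2 j t)
        (Function.update θ.2 j t i))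
      ((if i = j then smoothedError n (m + 1) θs θ (θ.2 i) else 0)
        - θ.1 j * (fejerDeriv n (m + 1) (θ.2 i - θ.2 j) : ℂ)) (θ.2 j) := by
  have hu : ∀ l, HasDerivAt (fun t : ℝ => Function.update θ.2 j t l)
      (if l = j then 1 else 0) (θ.2 j) := by
    intro l
    by_cases hl : l = j
    · subst hl
      simpa using hasDerivAt_id' (θ.2 l)
    · simp only [Function.update_of_ne hl, if_neg hl]
      exact hasDerivAt_const _ _
  have hself : ∀ l, Function.update θ.2 j (θ.2 j) l = θ.2 l := by simp
  have h1 : ∀ l ∈ Finset.univ, HasDerivAt (fun t : ℝ => θ.1 l *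
      (fejerDeriv n m (Function.update θ.2 j t i - Function.update θ.2 j t l) : ℂ))
      (θ.1 l * ((fejerDeriv n (m + 1) (θ.2 i - θ.2 l) *
        ((if i = j then 1 else 0) - (if l = j then 1 else 0)) : ℝ) : ℂ)) (θ.2 j) := by
    intro l _
    have := (hasDerivAt_fejerDeriv n m (Function.update θ.2 j (θ.2 j) i -
      Function.update θ.2 j (θ.2 j) l)).comp (θ.2 j) ((hu i).fun_sub (hu l))
    rw [hself, hself] at this
    exact this.ofReal_comp.const_mul _
  have h2 : ∀ l ∈ Finset.univ, HasDerivAt (fun t : ℝ => θs.1 l *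
      (fejerDeriv n m (Function.update θ.2 j t i - θs.2 l) : ℂ))
      (θs.1 l * ((fejerDeriv n (m + 1) (θ.2 i - θs.2 l) *
        (if i = j then 1 else 0) : ℝ) : ℂ)) (θ.2 j) := by
    intro l _
    have := (hasDerivAt_fejerDeriv n m (Function.update θ.2 j (θ.2 j) i - θs.2 l)).comp (θ.2 j)
      ((hu i).sub_const (θs.2 l))
    rw [hself] at this
    exact this.ofReal_comp.const_mul _
  refine ((HasDerivAt.fun_sum h1).fun_sub (HasDerivAt.fun_sum h2)).congr_deriv ?_
  have h3 : ∀ l, θ.1 l * ((fejerDeriv n (m + 1) (θ.2 i - θ.2 l) *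
        ((if i = j then 1 else 0) - (if l = j then 1 else 0)) : ℝ) : ℂ)
      = (if i = j then θ.1 l * (fejerDeriv n (m + 1) (θ.2 i - θ.2 l) : ℂ) else 0)
        - (if l = j then θ.1 l * (fejerDeriv n (m + 1) (θ.2 i - θ.2 l) : ℂ) else 0) := by
    intro l
    split_ifs <;> simp
  simp only [h3, Finset.sum_sub_distrib, Finset.sum_ite_eq', Finset.mem_univ, if_true]
  by_cases hij : i = j
  · simp only [hij, if_true, smoothedError, mul_one]
    ring
  · simp [hij]

lemma hessAA_loss (n : ℕ) {r : ℕ} (θs θ : Param r) (i j : Fin r) :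
    hessAA (loss n θs) θ i j = (fejerDeriv n 0 (θ.2 i - θ.2 j) : ℂ) := by
  rw [hessAA, Matrix.of_apply]
  simp only [gradAmp_loss, smoothedError]
  refine HasDerivAt.deriv ?_
  have h : ∀ l ∈ Finset.univ, HasDerivAt (fun z : ℂ => Function.update θ.1 j z l *
      (fejerDeriv n 0 (θ.2 i - θ.2 l) : ℂ))
      (if l = j then (fejerDeriv n 0 (θ.2 i - θ.2 l) : ℂ) else 0) (θ.1 j) := by
    intro l _
    by_cases hl : l = j
    · subst hl
      simpa using (hasDerivAt_id (θ.1 l)).mul_const (fejerDeriv n 0 (θ.2 i - θ.2 l) : ℂ)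
    · simp only [Function.update_of_ne hl, if_neg hl]
      exact hasDerivAt_const _ _
  refine ((HasDerivAt.fun_sum h).sub_const _).congr_deriv ?_
  simp

lemma hessAT_loss (n : ℕ) {r : ℕ} (θs θ : Param r) (i j : Fin r) :
    hessAT (loss n θs) θ i j = (if i = j then smoothedError n 1 θs θ (θ.2 i) else 0)
        - θ.1 j * (fejerDeriv n 1 (θ.2 i - θ.2 j) : ℂ) := by
  rw [hessAT, Matrix.of_apply]
  simp only [gradAmp_loss]
  exact (hasDerivAt_smoothedError_loc n 0 θs θ i j).deriv

lemma hessTT_loss (n : ℕ) {r : ℕ} (θs θ : Param r) (i j : Fin r) :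
    hessTT (loss n θs) θ i j = (((starRingEnd ℂ (θ.1 i) *
      ((if i = j then smoothedError n 2 θs θ (θ.2 i) else 0)
        - θ.1 j * (fejerDeriv n 2 (θ.2 i - θ.2 j) : ℂ))).re : ℝ) : ℂ) := by
  rw [hessTT, Matrix.of_apply]
  simp only [gradLoc_loss]
  congr 1
  have h := (hasDerivAt_smoothedError_loc n 1 θs θ i j).const_mul (starRingEnd ℂ (θ.1 i))
  exact (Complex.reCLM.hasFDerivAt.comp_hasDerivAt _ h).deriv

/-! ### Separated points -/

lemma sum_inv_sq_le_of_pos_separated {ι : Type*} (s : Finset ι) (v : ι → ℝ) {Δ : ℝ} (hΔ : 0 < Δ)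
    (hv : ∀ l ∈ s, Δ ≤ v l) (hsep : ∀ l ∈ s, ∀ l' ∈ s, l ≠ l' → Δ ≤ |v l - v l'|) :
    ∑ l ∈ s, 1 / v l ^ 2 ≤ 2 / Δ ^ 2 := by
  classical
  set k : ι → ℕ := fun l => ⌊v l / Δ⌋₊ with hk
  have hk1 : ∀ l ∈ s, 1 ≤ k l := fun l hl => by
    rw [hk, Nat.one_le_floor_iff, one_le_div hΔ]; exact hv l hl
  have hinj : Set.InjOn k s := by
    intro l hl l' hl' h
    by_contra hne
    have h1 := Nat.floor_le (div_nonneg (hΔ.le.trans (hv l hl)) hΔ.le)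
    have h2 := Nat.lt_floor_add_one (v l / Δ)
    have h1' := Nat.floor_le (div_nonneg (hΔ.le.trans (hv l' hl')) hΔ.le)
    have h2' := Nat.lt_floor_add_one (v l' / Δ)
    have h3 : (⌊v l / Δ⌋₊ : ℝ) = ⌊v l' / Δ⌋₊ := by exact_mod_cast h
    have h4 : |v l / Δ - v l' / Δ| < 1 := by rw [abs_lt]; constructor <;> linarith
    rw [← sub_div, abs_div, abs_of_pos hΔ, div_lt_one hΔ] at h4
    exact absurd (hsep l hl l' hl' hne) (not_le.mpr h4)
  have hterm : ∀ l ∈ s, 1 / v l ^ 2 ≤ ((k l : ℝ) ^ 2)⁻¹ * (1 / Δ ^ 2) := by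
    intro l hl
    have h1 := Nat.floor_le (div_nonneg (hΔ.le.trans (hv l hl)) hΔ.le)
    have h2 : (1 : ℝ) ≤ k l := by exact_mod_cast hk1 l hl
    have h3 : (k l : ℝ) * Δ ≤ v l := (le_div_iff₀ hΔ).mp h1
    have h4 : 0 < (k l : ℝ) * Δ := by positivity
    rw [← one_div, one_div_mul_one_div, ← mul_pow]
    exact one_div_le_one_div_of_le (by positivity) (pow_le_pow_left₀ h4.le h3 2)
  refine (Finset.sum_le_sum hterm).trans ?_
  rw [← Finset.sum_mul, ← Finset.sum_image (f := fun m : ℕ => ((m : ℝ) ^ 2)⁻¹) hinj]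
  have hsub : s.image k ⊆ Finset.Ioo 0 ((s.image k).sup id + 1) := by
    intro m hm
    obtain ⟨l, hl, rfl⟩ := Finset.mem_image.mp hm
    rw [Finset.mem_Ioo]
    exact ⟨hk1 l hl, Nat.lt_succ_of_le (Finset.le_sup (f := id) hm)⟩
  have h5 := (Finset.sum_le_sum_of_subset_of_nonneg hsub
    (fun m _ _ => by positivity : ∀ m ∈ Finset.Ioo 0 ((s.image k).sup id + 1), m ∉ s.image k →
      0 ≤ ((m : ℝ) ^ 2)⁻¹)).trans (sum_Ioo_inv_sq_le (α := ℝ) 0 _)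
  have h6 : (∑ m ∈ s.image k, ((m : ℝ) ^ 2)⁻¹) ≤ 2 := by simpa using h5
  calc _ ≤ 2 * (1 / Δ ^ 2) := mul_le_mul_of_nonneg_right h6 (by positivity)
    _ = _ := by ring

lemma sum_inv_sq_le_of_separated {ι : Type*} (s : Finset ι) (v : ι → ℝ) {Δ : ℝ} (hΔ : 0 < Δ)
    (hv : ∀ l ∈ s, Δ ≤ |v l|) (hsep : ∀ l ∈ s, ∀ l' ∈ s, l ≠ l' → Δ ≤ |v l - v l'|) :
    ∑ l ∈ s, 1 / v l ^ 2 ≤ 4 / Δ ^ 2 := by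
  classical
  rw [← Finset.sum_filter_add_sum_filter_not s (fun l => 0 ≤ v l)]
  have h1 : ∑ l ∈ s with 0 ≤ v l, 1 / v l ^ 2 ≤ 2 / Δ ^ 2 := by
    refine sum_inv_sq_le_of_pos_separated _ v hΔ (fun l hl => ?_) fun l hl l' hl' => ?_
    · rw [Finset.mem_filter] at hl
      simpa [abs_of_nonneg hl.2] using hv l hl.1
    · exact hsep l (Finset.mem_filter.mp hl).1 l' (Finset.mem_filter.mp hl').1
  have h2 : ∑ l ∈ s with ¬ 0 ≤ v l, 1 / (-v l) ^ 2 ≤ 2 / Δ ^ 2 := by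
    refine sum_inv_sq_le_of_pos_separated _ (fun l => -v l) hΔ (fun l hl => ?_)
      fun l hl l' hl' hne => ?_
    · rw [Finset.mem_filter] at hl
      simpa [abs_of_neg (not_le.mp hl.2)] using hv l hl.1
    · have := hsep l (Finset.mem_filter.mp hl).1 l' (Finset.mem_filter.mp hl').1 hne
      rwa [neg_sub_neg, abs_sub_comm]
  simp only [neg_sq] at h2
  calc _ ≤ 2 / Δ ^ 2 + 2 / Δ ^ 2 := add_le_add h1 h2
    _ = _ := by ring

/-- The distance of `t` to the nearest integer. -/
noncomputable def wrapDist (t : ℝ) : ℝ := |t - round t|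

lemma sum_inv_wrapDist_sq_le {r : ℕ} (τ : Fin r → ℝ) {Δ : ℝ} (hΔ : 0 < Δ)
    (hsep : ∀ l l', l ≠ l' → ∀ p : ℤ, Δ ≤ |τ l - τ l' + p|) (i : Fin r) :
    ∑ l ∈ Finset.univ.erase i, 1 / wrapDist (τ i - τ l) ^ 2 ≤ 4 / Δ ^ 2 := by
  simp only [wrapDist, sq_abs]
  refine sum_inv_sq_le_of_separated _ (fun l => τ i - τ l - round (τ i - τ l)) hΔ
    (fun l hl => ?_) fun l _ l' _ hne => ?_
  · have := hsep i l (Finset.ne_of_mem_erase hl).symm (-round (τ i - τ l))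
    simpa [sub_eq_add_neg] using this
  · have := hsep l' l hne.symm (round (τ i - τ l') - round (τ i - τ l))
    convert this using 2
    push_cast
    ring

lemma two_mul_wrapDist_le_abs_sin (x : ℝ) : 2 * wrapDist x ≤ |Real.sin (Real.pi * x)| := by
  have hp := Real.pi_pos
  have h0 : |Real.pi * (x - round x)| ≤ Real.pi / 2 := by
    rw [abs_mul, abs_of_pos hp]
    nlinarith [abs_sub_round x]
  have h1 := Real.mul_abs_le_abs_sin h0
  rw [abs_mul, abs_of_pos hp, mul_sub, mul_comm Real.pi (round x : ℝ), Real.sin_sub_int_mul_pi,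
    abs_mul] at h1
  have h2 : |(-1 : ℝ) ^ round x| = 1 := by simp [abs_zpow]
  rw [h2, one_mul, ← mul_assoc, div_mul_cancel₀ _ hp.ne'] at h1
  exact h1

lemma wrapDist_sub_le (t x : ℝ) : wrapDist t - |x - t| ≤ wrapDist x := by
  have h1 := round_le t (round x)
  have h2 : |t - round x| ≤ |x - round x| + |x - t| := by
    have := abs_sub_le t x (round x)
    rw [abs_sub_comm t x] at this
    linarith
  unfold wrapDist
  linarith

/-- The constants in the decay of the derivatives of the kernel. -/
noncomputable def decayConst : ℕ → ℝ
  | 0 => 0.37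
  | 1 => 0.56
  | 2 => 1.43
  | _ => 3.97

lemma decayConst_nonneg (m : ℕ) : 0 ≤ decayConst m := by
  unfold decayConst
  split <;> norm_num

/-- Decay of the kernel in a neighbourhood of a point `t` which is far from the integers. -/
lemma abs_fejerDeriv_le_of_near {n : ℕ} (hn : 9 ≤ n) {t x : ℝ}
    (ht : 4.7 ≤ ((n : ℝ) + 1) * wrapDist t) (hx : Real.sqrt (curv n) * |x - t| ≤ 2)
    {m : ℕ} (hm : m ≤ 3) :
    |fejerDeriv n m x| ≤ decayConst m * Real.sqrt (curv n) ^ m *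
      (1 / (((n : ℝ) + 1) * wrapDist t) ^ 2) := by
  have hn' : (9 : ℝ) ≤ n := by exact_mod_cast hn
  have hM : (10 : ℝ) ≤ (n : ℝ) + 1 := by linarith
  set M : ℝ := (n : ℝ) + 1 with hMdef
  set z : ℝ := M * wrapDist t with hz
  set s : ℝ := Real.sqrt (curv n) with hs
  have hpi := Real.pi_gt_d2
  set w : ℝ := Real.pi * M with hw
  have hw0 : 0 < w := by positivity
  have hw31 : 3.14 * M ≤ w := mul_le_mul_of_nonneg_right hpi.le (by linarith)
  have hs2 : 0.66 * w ^ 2 ≤ s ^ 2 := by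
    rw [hs, Real.sq_sqrt (curv_pos (by omega)).le, curv_eq, ← hMdef, hw, mul_pow]
    have : 0.66 * M ^ 2 ≤ 2 / 3 * (M ^ 2 - 1) := by nlinarith
    have := mul_le_mul_of_nonneg_left this (sq_nonneg Real.pi)
    linarith
  have hs0 : 0 ≤ s := Real.sqrt_nonneg _
  have hs1 : 0.8124 * w ≤ s := by
    refine (abs_le_of_sq_le_sq' (le_trans ?_ hs2) hs0).2
    rw [mul_pow]
    exact mul_le_mul_of_nonneg_right (by norm_num) (sq_nonneg w)
  have hs3 : 0.536 * w ^ 3 ≤ s ^ 3 := by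
    calc 0.536 * w ^ 3 ≤ 0.8124 * 0.66 * w ^ 3 :=
          mul_le_mul_of_nonneg_right (by norm_num) (by positivity)
      _ = 0.8124 * w * (0.66 * w ^ 2) := by ring
      _ ≤ s * s ^ 2 := mul_le_mul hs1 hs2 (by positivity) hs0
      _ = s ^ 3 := by ring
  have hxM : M * |x - t| ≤ 0.7841 := by
    have h1 : 2.5509 * M ≤ s := by linarith
    have h2 : 2.5509 * M * |x - t| ≤ 2 :=
      (mul_le_mul_of_nonneg_right h1 (abs_nonneg _)).trans hx
    linarith
  set y : ℝ := M * |Real.sin (Real.pi * x)| with hy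
  have hyz : 1.666 * z ≤ y := by
    have h1 := two_mul_wrapDist_le_abs_sin x
    have h2 := wrapDist_sub_le t x
    have h3 : M * (2 * (wrapDist t - |x - t|)) ≤ y :=
      mul_le_mul_of_nonneg_left (by linarith) (by linarith)
    have h4 : M * (2 * (wrapDist t - |x - t|)) = 2 * z - 2 * (M * |x - t|) := by
      rw [hz]; ring
    rw [h4] at h3
    linarith
  have hz0 : 0 < z := by linarith
  have hy0 : 0 < y := by linarith
  obtain ⟨d0, d1, d2, d3⟩ := fejerDeriv_decay n hy0 hy
  have hq : 1 / y ≤ 0.1278 := by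
    rw [div_le_iff₀ hy0]; linarith
  have hq0 : 0 ≤ 1 / y := by positivity
  set q : ℝ := 1 / y with hqdef
  have hq2 : q ^ 2 ≤ 0.3603 * (1 / z ^ 2) := by
    have h1 : q ≤ 1 / (1.666 * z) := one_div_le_one_div_of_le (by positivity) hyz
    have h2 : q ^ 2 ≤ (1 / (1.666 * z)) ^ 2 := pow_le_pow_left₀ hq0 h1 2
    refine h2.trans ?_
    rw [div_pow, mul_pow, one_pow, ← one_div_mul_one_div]
    exact mul_le_mul_of_nonneg_right (by norm_num) (by positivity)
  have e : ∀ (c : ℝ) (k : ℕ), c / y ^ k = c * q ^ k := fun c k => by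
    rw [hqdef, one_div, inv_pow, div_eq_mul_inv]
  set E : ℝ := 1 / z ^ 2 with hE
  have hE0 : 0 ≤ E := by positivity
  have qs : ∀ k : ℕ, q ^ (k + 1) ≤ 0.1278 * q ^ k := fun k => by
    rw [pow_succ']
    exact mul_le_mul_of_nonneg_right hq (pow_nonneg hq0 k)
  have q3 : q ^ 3 ≤ 0.1278 * q ^ 2 := qs 2
  have q4 : q ^ 4 ≤ 0.1278 * q ^ 3 := qs 3
  have q5 : q ^ 5 ≤ 0.1278 * q ^ 4 := qs 4
  simp only [e] at d0 d1 d2 d3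
  have comb : ∀ {z A B C : ℝ} {k : ℕ}, |fejerDeriv n k x| ≤ w ^ k * z → z ≤ A * E → A ≤ B * C →
      0 ≤ B → C * w ^ k ≤ s ^ k → |fejerDeriv n k x| ≤ B * s ^ k * E := by
    intro z A B C k h1 h2 h3 h4 h5
    have h6 := mul_le_mul_of_nonneg_left h5 h4
    have hwk : 0 ≤ w ^ k := by positivity
    calc _ ≤ w ^ k * z := h1
      _ ≤ w ^ k * (A * E) := mul_le_mul_of_nonneg_left h2 hwk
      _ ≤ w ^ k * (B * C * E) :=
        mul_le_mul_of_nonneg_left (mul_le_mul_of_nonneg_right h3 hE0) hwk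
      _ = B * (C * w ^ k) * E := by ring
      _ ≤ B * s ^ k * E := mul_le_mul_of_nonneg_right h6 hE0
  interval_cases m
  · simp only [decayConst, pow_zero, mul_one]
    linarith
  · refine comb (k := 1) (A := 0.4525) (C := 0.8124) (by rw [pow_one]; exact d1) (by linarith)
      (by norm_num [decayConst]) (decayConst_nonneg 1) (by simpa using hs1)
  · exact comb (k := 2) (A := 0.9402) (C := 0.66) d2 (by linarith)
      (by norm_num [decayConst]) (decayConst_nonneg 2) hs2
  · exact comb (k := 3) (A := 2.118) (C := 0.536) d3 (by linarith)
      (by norm_num [decayConst]) (decayConst_nonneg 3) hs3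

/-! ### The contribution of a single spike -/

lemma single_spike_upper {ε u b V x ρ : ℝ} (hε0 : 0 ≤ ε) (hε1 : ε < 1) (hu0 : 0 ≤ u) (hu1 : u ≤ 1)
    (hb : |b| ≤ ε) (hV : (1 + b) ^ 2 ≤ V) (hx : x ≤ u * ε) (hρ : ρ ≤ 1) :
    (1 - ε) ^ 2 * (x + ρ * (1 + u * b)) ≤ V := by
  obtain ⟨hb1, hb2⟩ := abs_le.mp hb
  have h1 : 0 ≤ 1 + u * b := by nlinarith
  have h2 : x + ρ * (1 + u * b) ≤ 1 + ε + b := by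
    nlinarith [mul_le_mul_of_nonneg_right hρ h1]
  refine le_trans (mul_le_mul_of_nonneg_left h2 (sq_nonneg _)) (le_trans ?_ hV)
  have h3 : 0 ≤ (b + ε) * ((1 + b) + (1 - ε) - (1 - ε) ^ 2) :=
    mul_nonneg (by linarith) (by nlinarith)
  nlinarith

lemma single_spike_lower {ε u b V x ρ : ℝ} (hε0 : 0 ≤ ε) (hε1 : ε < 1) (hu0 : 0 ≤ u) (hu1 : u ≤ 1)
    (hb : |b| ≤ ε) (hV : (1 + b) ^ 2 ≤ V) (hV' : V ≤ 1 + 2 * b + ε ^ 2) (hx : x ≤ u * ε)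
    (hρ : 1 - 6 / 5 * (u * ε) ^ 2 ≤ ρ) :
    (1 - ε) ^ 2 * (x - ρ * (1 + u * b)) ≤ V * (1 - 2 * (1 - ε) ^ 2) := by
  obtain ⟨hb1, hb2⟩ := abs_le.mp hb
  have h1 : 0 ≤ 1 + u * b := by nlinarith
  have hbr : 0 ≤ ε - b + 6 / 5 * ε ^ 2 * (1 + u + b * (1 + u + u ^ 2)) := by
    have hε2 : ε ^ 2 ≤ 1 := by nlinarith
    rcases le_total 0 b with hb0 | hb0
    · have : 0 ≤ 6 / 5 * ε ^ 2 * (1 + u + b * (1 + u + u ^ 2)) := by positivity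
      linarith
    · have h2 : b ≤ 1 + u + b * (1 + u + u ^ 2) := by
        have hu2 : u ^ 2 ≤ 1 := by nlinarith
        nlinarith [mul_nonneg (by linarith : (0 : ℝ) ≤ 1 + u) (by linarith : 0 ≤ 1 + b)]
      nlinarith [mul_le_mul_of_nonneg_left h2 (sq_nonneg ε)]
  have hN : x - ρ * (1 + u * b) ≤ ε - b - 1 + 6 / 5 * ε ^ 2 * (1 + b) := by
    nlinarith [mul_le_mul_of_nonneg_right hρ h1, mul_nonneg (by linarith : 0 ≤ 1 - u) hbr]
  refine (mul_le_mul_of_nonneg_left hN (sq_nonneg _)).trans ?_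
  obtain ⟨e, rfl⟩ : ∃ e, ε = 1 - e := ⟨1 - ε, by ring⟩
  obtain ⟨w, rfl⟩ : ∃ w, b = w - 1 := ⟨b + 1, by ring⟩
  have he0 : 0 < e := by linarith
  have he1 : e ≤ 1 := by linarith
  have hw1 : e ≤ w := by linarith
  have hw2 : w ≤ 2 - e := by linarith
  have hbase : 0 ≤ e ^ 3 * ((1 - e) * (2 - 6 / 5 * (1 - e))) :=
    mul_nonneg (by positivity) (mul_nonneg (by linarith) (by linarith))
  rcases le_total 0 (1 - 2 * e ^ 2) with hq | hq
  · have h3 : (1 + (w - 1)) ^ 2 * (1 - 2 * e ^ 2) ≤ V * (1 - 2 * e ^ 2) :=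
      mul_le_mul_of_nonneg_right hV hq
    have h4 : 0 ≤ (w - e) * ((w + e) * (1 - 2 * e ^ 2) + e ^ 2 * (1 - 6 / 5 * (1 - e) ^ 2)) := by
      refine mul_nonneg (by linarith) ?_
      have h5 : 2 * e * (1 - 2 * e ^ 2) ≤ (w + e) * (1 - 2 * e ^ 2) :=
        mul_le_mul_of_nonneg_right (by linarith) hq
      have h6 : 0 ≤ e * (2 * (1 - 2 * e ^ 2) + e * (1 - 6 / 5 * (1 - e) ^ 2)) := by
        refine mul_nonneg he0.le ?_
        have h7 : 0 ≤ e * (1 - 2 * e ^ 2) := mul_nonneg he0.le hq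
        nlinarith
      nlinarith
    linarith
  · have h3 : (1 + 2 * (w - 1) + (1 - e) ^ 2) * (1 - 2 * e ^ 2) ≤ V * (1 - 2 * e ^ 2) :=
      mul_le_mul_of_nonpos_right hV' hq
    refine le_trans ?_ (by simpa using h3)
    have hL : 0 ≤ e ^ 2 * (1 - 2 * e ^ 2) - e ^ 2 * ((1 - e) - e * (1 - 6 / 5 * (1 - e) ^ 2)) := by
      linarith
    have hR : 0 ≤ (2 - e) ^ 2 * (1 - 2 * e ^ 2)
        - e ^ 2 * ((1 - e) - (2 - e) * (1 - 6 / 5 * (1 - e) ^ 2)) := by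
      have h5 : 0 ≤ 4 + 4 * e - 22 / 5 * e ^ 2 + 6 / 5 * e ^ 3 := by
        have := pow_pos he0 3
        nlinarith
      have h6 := mul_nonneg (sq_nonneg (1 - e)) h5
      linarith
    rcases eq_or_lt_of_le he1 with rfl | he1'
    · have : w = 1 := by linarith
      subst this
      norm_num
    · have hcomb : 0 ≤ (2 - 2 * e) * ((2 * w - 2 * e + e ^ 2) * (1 - 2 * e ^ 2)
        - e ^ 2 * ((1 - e) - w * (1 - 6 / 5 * (1 - e) ^ 2))) := by
        have h5 := mul_nonneg (sub_nonneg.mpr hw2) hL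
        have h6 := mul_nonneg (sub_nonneg.mpr hw1) hR
        linarith
      have := nonneg_of_mul_nonneg_right hcomb (by linarith)
      linarith

/-- The bound for the diagonal part of a location row. -/
lemma single_spike_bound {ε u b V x ρ : ℝ} (hε0 : 0 ≤ ε) (hε1 : ε < 1) (hu0 : 0 ≤ u) (hu1 : u ≤ 1)
    (hb : |b| ≤ ε) (hV : (1 + b) ^ 2 ≤ V) (hV' : V ≤ 1 + 2 * b + ε ^ 2) (hx : x ≤ u * ε)
    (hρ : 1 - 6 / 5 * (u * ε) ^ 2 ≤ ρ) (hρ1 : ρ ≤ 1) :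
    V⁻¹ * x + |V⁻¹ * (ρ * (1 + u * b)) - 1| ≤ 1 / (1 - ε) ^ 2 - 1 := by
  have h1 := single_spike_upper hε0 hε1 hu0 hu1 hb hV hx hρ1
  have h2 := single_spike_lower hε0 hε1 hu0 hu1 hb hV hV' hx hρ
  have hb1 := (abs_le.mp hb).1
  have hV0 : 0 < V := lt_of_lt_of_le (pow_pos (by linarith) 2) hV
  have he : 0 < (1 - ε) ^ 2 := pow_pos (by linarith) 2
  have h3 : V⁻¹ * (x + ρ * (1 + u * b)) ≤ 1 / (1 - ε) ^ 2 := by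
    rw [inv_mul_le_iff₀ hV0, mul_one_div, le_div_iff₀ he]
    linarith
  have h4 : V⁻¹ * (x - ρ * (1 + u * b)) ≤ 1 / (1 - ε) ^ 2 - 2 := by
    rw [inv_mul_le_iff₀ hV0, div_sub' he.ne', mul_div_assoc', le_div_iff₀ he]
    linarith
  rw [mul_add] at h3
  rw [mul_sub] at h4
  rcases abs_cases (V⁻¹ * (ρ * (1 + u * b)) - 1) with h | h <;> rw [h.1] <;> linarith

/-! ### Row sums of the preconditioned Hessian -/

lemma fejerDeriv_zero_zero (n : ℕ) : fejerDeriv n 0 0 = 1 := by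
  have h1 : ∀ n : ℕ, ∀ M : ℝ, ∑ k ∈ Finset.range n, (M - ((k : ℝ) + 1))
      = M * n - n * (n + 1) / 2 := by
    intro n M
    induction n with
    | zero => simp
    | succ n ih => rw [Finset.sum_range_succ, ih]; push_cast; ring
  have hM : (n : ℝ) + 1 ≠ 0 := by positivity
  have h2 : ∀ k : ℕ, sqWeight n ((k : ℤ) + 1) + sqWeight n (-((k : ℤ) + 1))
      = 2 / ((n : ℝ) + 1) ^ 2 * (((n : ℝ) + 1) - ((k : ℝ) + 1)) := by
    intro k
    rw [sqWeight_neg]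
    unfold sqWeight
    have hk : |((k : ℝ) + 1)| = (k : ℝ) + 1 := abs_of_nonneg (by positivity)
    push_cast
    rw [hk]
    field_simp
    ring
  simp only [fejerDeriv, pow_zero, mul_one, mul_zero, Nat.cast_zero, zero_mul, add_zero,
    Real.cos_zero]
  rw [sum_Icc_neg_eq_range]
  simp only [h2, ← Finset.mul_sum, h1]
  simp only [sqWeight, Int.cast_zero, abs_zero, zero_div]
  field_simp
  ring

/-- The points `θ` whose weighted distance to `θs` is at most `ε`, for a ground truth `θs` with
dynamic range at most `R` and with decay weights `w` of row sums at most `4 η`. -/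
structure IsNear (n : ℕ) {r : ℕ} (θs θ : Param r) (ε R η : ℝ) (w : Fin r → Fin r → ℝ) :
    Prop where
  one_le : 1 ≤ n
  eps_nonneg : 0 ≤ ε
  eps_le_one : ε ≤ 1
  amp : ∀ l, ‖θ.1 l - θs.1 l‖ ≤ ε * ‖θs.1 l‖
  loc : ∀ l, Real.sqrt (curv n) * |θ.2 l - θs.2 l| ≤ ε
  range : ∀ i j, ‖θs.1 j‖ ≤ R * ‖θs.1 i‖
  decay : ∀ i l, i ≠ l → ∀ x, Real.sqrt (curv n) * |x - (θs.2 i - θs.2 l)| ≤ 2 → ∀ m ≤ 3,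
    |fejerDeriv n m x| ≤ decayConst m * Real.sqrt (curv n) ^ m * w i l
  nonneg : ∀ i l, 0 ≤ w i l
  sum_le : ∀ i, ∑ l ∈ Finset.univ.erase i, w i l ≤ 4 * η

namespace IsNear

variable {n r : ℕ} {θs θ : Param r} {ε R η : ℝ} {w : Fin r → Fin r → ℝ}

lemma sqrt_pos (h : IsNear n θs θ ε R η w) : 0 < Real.sqrt (curv n) :=
  Real.sqrt_pos.mpr (curv_pos h.one_le)

lemma amp_le (h : IsNear n θs θ ε R η w) (l : Fin r) : ‖θ.1 l‖ ≤ (1 + ε) * ‖θs.1 l‖ := by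
  have h1 := norm_add_le (θ.1 l - θs.1 l) (θs.1 l)
  rw [sub_add_cancel] at h1
  linarith [h.amp l]

lemma sum_norm_mul_le (h : IsNear n θs θ ε R η w) (i : Fin r) :
    ∑ l ∈ Finset.univ.erase i, ‖θs.1 l‖ * w i l ≤ ‖θs.1 i‖ * (R * (4 * η)) := by
  have hR : 0 ≤ R * ‖θs.1 i‖ := (norm_nonneg _).trans (h.range i i)
  calc _ ≤ ∑ l ∈ Finset.univ.erase i, R * ‖θs.1 i‖ * w i l :=
        Finset.sum_le_sum fun l _ => mul_le_mul_of_nonneg_right (h.range i l) (h.nonneg i l)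
    _ ≤ R * ‖θs.1 i‖ * (4 * η) := by
        rw [← Finset.mul_sum]
        exact mul_le_mul_of_nonneg_left (h.sum_le i) hR
    _ = _ := by ring

lemma decay_loc (h : IsNear n θs θ ε R η w) {i l : Fin r} (hil : i ≠ l) {m : ℕ} (hm : m ≤ 3) :
    |fejerDeriv n m (θ.2 i - θ.2 l)| ≤ decayConst m * Real.sqrt (curv n) ^ m * w i l := by
  refine h.decay i l hil _ ?_ m hm
  have h1 : |θ.2 i - θ.2 l - (θs.2 i - θs.2 l)| ≤ |θ.2 i - θs.2 i| + |θ.2 l - θs.2 l| := by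
    have : θ.2 i - θ.2 l - (θs.2 i - θs.2 l) = (θ.2 i - θs.2 i) - (θ.2 l - θs.2 l) := by ring
    rw [this]
    exact abs_sub _ _
  have h2 := mul_le_mul_of_nonneg_left h1 h.sqrt_pos.le
  linarith [h.loc i, h.loc l, h.eps_le_one]

lemma variation (h : IsNear n θs θ ε R η w) {i l : Fin r} (hil : i ≠ l) {m : ℕ} (hm : m ≤ 2) :
    |fejerDeriv n m (θ.2 i - θ.2 l) - fejerDeriv n m (θ.2 i - θs.2 l)|
      ≤ ε * decayConst (m + 1) * Real.sqrt (curv n) ^ m * w i l := by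
  have hs := h.sqrt_pos
  set s := Real.sqrt (curv n) with hsdef
  have key := (convex_uIcc (θ.2 i - θs.2 l) (θ.2 i - θ.2 l)).norm_image_sub_le_of_norm_hasDerivWithin_le
    (f := fejerDeriv n m) (f' := fejerDeriv n (m + 1))
    (C := decayConst (m + 1) * s ^ (m + 1) * w i l)
    (fun x _ => (hasDerivAt_fejerDeriv n m x).hasDerivWithinAt)
    (fun x hx => h.decay i l hil x ?_ (m + 1) (by omega)) Set.left_mem_uIcc Set.right_mem_uIcc
  · rw [Real.norm_eq_abs, Real.norm_eq_abs] at key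
    refine key.trans ?_
    have h1 : θ.2 i - θ.2 l - (θ.2 i - θs.2 l) = -(θ.2 l - θs.2 l) := by ring
    rw [h1, abs_neg]
    have h2 : 0 ≤ decayConst (m + 1) * s ^ m * w i l :=
      mul_nonneg (mul_nonneg (decayConst_nonneg _) (by positivity)) (h.nonneg i l)
    calc _ = decayConst (m + 1) * s ^ m * w i l * (s * |θ.2 l - θs.2 l|) := by ring
      _ ≤ decayConst (m + 1) * s ^ m * w i l * ε := mul_le_mul_of_nonneg_left (h.loc l) h2
      _ = _ := by ring
  · have h1 : |x - (θ.2 i - θs.2 l)| ≤ |θ.2 l - θs.2 l| := by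
      have := Set.abs_sub_left_of_mem_uIcc hx
      rwa [show θ.2 i - θ.2 l - (θ.2 i - θs.2 l) = -(θ.2 l - θs.2 l) by ring, abs_neg] at this
    have h2 : |x - (θs.2 i - θs.2 l)| ≤ |θ.2 l - θs.2 l| + |θ.2 i - θs.2 i| := by
      have : x - (θs.2 i - θs.2 l) = (x - (θ.2 i - θs.2 l)) + (θ.2 i - θs.2 i) := by ring
      rw [this]
      exact (abs_add_le _ _).trans (by linarith)
    have h3 := mul_le_mul_of_nonneg_left h2 hs.le
    linarith [h.loc i, h.loc l, h.eps_le_one]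

lemma norm_interaction_le (h : IsNear n θs θ ε R η w) (i : Fin r) {m : ℕ} (hm : m ≤ 2) :
    ‖smoothedError n m θs θ (θ.2 i) - θ.1 i * (fejerDeriv n m 0 : ℂ)
        + θs.1 i * (fejerDeriv n m (θ.2 i - θs.2 i) : ℂ)‖
      ≤ ε * (decayConst m + decayConst (m + 1)) * Real.sqrt (curv n) ^ m *
        (‖θs.1 i‖ * (R * (4 * η))) := by
  have hs := h.sqrt_pos
  set s := Real.sqrt (curv n) with hsdef
  have h1 : smoothedError n m θs θ (θ.2 i) - θ.1 i * (fejerDeriv n m 0 : ℂ)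
        + θs.1 i * (fejerDeriv n m (θ.2 i - θs.2 i) : ℂ)
      = ∑ l ∈ Finset.univ.erase i, ((θ.1 l - θs.1 l) * (fejerDeriv n m (θ.2 i - θ.2 l) : ℂ)
        + θs.1 l * ((fejerDeriv n m (θ.2 i - θ.2 l) - fejerDeriv n m (θ.2 i - θs.2 l) : ℝ) : ℂ))
      := by
    have h2 : ∀ l, (θ.1 l - θs.1 l) * (fejerDeriv n m (θ.2 i - θ.2 l) : ℂ)
        + θs.1 l * ((fejerDeriv n m (θ.2 i - θ.2 l) - fejerDeriv n m (θ.2 i - θs.2 l) : ℝ) : ℂ)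
        = θ.1 l * (fejerDeriv n m (θ.2 i - θ.2 l) : ℂ)
          - θs.1 l * (fejerDeriv n m (θ.2 i - θs.2 l) : ℂ) := by
      intro l; push_cast; ring
    simp only [h2, Finset.sum_sub_distrib, smoothedError]
    rw [← Finset.add_sum_erase _ _ (Finset.mem_univ i),
      ← Finset.add_sum_erase _ (fun l => θs.1 l * (fejerDeriv n m (θ.2 i - θs.2 l) : ℂ))
        (Finset.mem_univ i), sub_self]
    ring
  rw [h1]
  have h3 : ∀ l ∈ Finset.univ.erase i,
      ‖(θ.1 l - θs.1 l) * (fejerDeriv n m (θ.2 i - θ.2 l) : ℂ)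
        + θs.1 l * ((fejerDeriv n m (θ.2 i - θ.2 l) - fejerDeriv n m (θ.2 i - θs.2 l) : ℝ) : ℂ)‖
      ≤ ε * (decayConst m + decayConst (m + 1)) * s ^ m * (‖θs.1 l‖ * w i l) := by
    intro l hl
    have hil := (Finset.ne_of_mem_erase hl).symm
    refine (norm_add_le _ _).trans ?_
    rw [norm_mul, norm_mul, Complex.norm_real, Complex.norm_real, Real.norm_eq_abs,
      Real.norm_eq_abs]
    have e1 := mul_le_mul (h.amp l) (h.decay_loc hil (by omega : m ≤ 3)) (abs_nonneg _)
      (mul_nonneg h.eps_nonneg (norm_nonneg _))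
    have e2 := mul_le_mul_of_nonneg_left (h.variation hil hm) (norm_nonneg (θs.1 l))
    refine (add_le_add e1 e2).trans (le_of_eq ?_)
    ring
  refine (norm_sum_le_of_le _ h3).trans ?_
  rw [← Finset.mul_sum]
  refine mul_le_mul_of_nonneg_left (h.sum_norm_mul_le i) ?_
  have := decayConst_nonneg m
  have := decayConst_nonneg (m + 1)
  have := h.eps_nonneg
  positivity

lemma norm_hessAA_le (h : IsNear n θs θ ε R η w) {i j : Fin r} (hij : i ≠ j) :
    ‖hessAA (loss n θs) θ i j‖ ≤ 0.37 * w i j := by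
  rw [hessAA_loss, Complex.norm_real, Real.norm_eq_abs]
  simpa [decayConst] using h.decay_loc hij (by norm_num : 0 ≤ 3)

lemma norm_hessAT_le (h : IsNear n θs θ ε R η w) {i j : Fin r} (hij : i ≠ j) :
    ‖hessAT (loss n θs) θ i j‖ ≤ (1 + ε) * ‖θs.1 j‖ * (0.56 * Real.sqrt (curv n) * w i j) := by
  rw [hessAT_loss, if_neg hij, zero_sub, norm_neg, norm_mul, Complex.norm_real, Real.norm_eq_abs]
  have h1 := h.decay_loc hij (by norm_num : 1 ≤ 3)
  rw [pow_one] at h1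
  exact mul_le_mul (h.amp_le j) h1 (abs_nonneg _)
    (mul_nonneg (by linarith [h.eps_nonneg]) (norm_nonneg _))

lemma norm_hessAT_swap_le (h : IsNear n θs θ ε R η w) {i j : Fin r} (hij : i ≠ j) :
    ‖hessAT (loss n θs) θ j i‖ ≤ (1 + ε) * ‖θs.1 i‖ * (0.56 * Real.sqrt (curv n) * w i j) := by
  rw [hessAT_loss, if_neg hij.symm, zero_sub, norm_neg, norm_mul, Complex.norm_real,
    Real.norm_eq_abs, ← neg_sub (θ.2 i), fejerDeriv_neg, pow_one, neg_one_mul, abs_neg]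
  have h1 := h.decay_loc hij (by norm_num : 1 ≤ 3)
  rw [pow_one] at h1
  exact mul_le_mul (h.amp_le i) h1 (abs_nonneg _)
    (mul_nonneg (by linarith [h.eps_nonneg]) (norm_nonneg _))

lemma norm_hessAT_self_le (h : IsNear n θs θ ε R η w) (i : Fin r) :
    ‖hessAT (loss n θs) θ i i‖ ≤ ‖θs.1 i‖ * |fejerDeriv n 1 (θ.2 i - θs.2 i)|
      + ε * 1.99 * Real.sqrt (curv n) * (‖θs.1 i‖ * (R * (4 * η))) := by
  have h1 := h.norm_interaction_le i (by norm_num : 1 ≤ 2)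
  have h2 : hessAT (loss n θs) θ i i
      = (smoothedError n 1 θs θ (θ.2 i) - θ.1 i * (fejerDeriv n 1 0 : ℂ)
        + θs.1 i * (fejerDeriv n 1 (θ.2 i - θs.2 i) : ℂ))
        - θs.1 i * (fejerDeriv n 1 (θ.2 i - θs.2 i) : ℂ) := by
    rw [hessAT_loss, if_pos rfl, sub_self]
    ring
  rw [h2]
  refine (norm_sub_le _ _).trans ?_
  rw [norm_mul, Complex.norm_real, Real.norm_eq_abs, add_comm]
  refine add_le_add_right (h1.trans (le_of_eq ?_)) _
  rw [pow_one]
  norm_num [decayConst]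

lemma norm_hessTT_le (h : IsNear n θs θ ε R η w) {i j : Fin r} (hij : i ≠ j) :
    ‖hessTT (loss n θs) θ i j‖
      ≤ (1 + ε) ^ 2 * ‖θs.1 i‖ * ‖θs.1 j‖ * (1.43 * curv n * w i j) := by
  have hc := Real.sq_sqrt (curv_pos h.one_le).le
  rw [hessTT_loss, if_neg hij, zero_sub, Complex.norm_real]
  refine (Complex.abs_re_le_norm _).trans ?_
  rw [norm_mul, norm_neg, norm_mul, Complex.norm_real, Real.norm_eq_abs, RCLike.norm_conj]
  have h1 := h.decay_loc hij (by norm_num : 2 ≤ 3)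
  rw [hc] at h1
  have h0 : ∀ l, 0 ≤ (1 + ε) * ‖θs.1 l‖ := fun l =>
    mul_nonneg (by linarith [h.eps_nonneg]) (norm_nonneg _)
  refine (mul_le_mul (h.amp_le i) (mul_le_mul (h.amp_le j) h1 (abs_nonneg _) (h0 j))
    (by positivity) (h0 i)).trans (le_of_eq ?_)
  simp only [decayConst]
  ring

lemma abs_hessTT_self_sub_le (h : IsNear n θs θ ε R η w) (i : Fin r) :
    ‖hessTT (loss n θs) θ i i - (((starRingEnd ℂ (θ.1 i) * θs.1 i).re *
        -fejerDeriv n 2 (θ.2 i - θs.2 i) : ℝ) : ℂ)‖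
      ≤ (1 + ε) * ‖θs.1 i‖ * (ε * 5.4 * curv n * (‖θs.1 i‖ * (R * (4 * η)))) := by
  have hc := Real.sq_sqrt (curv_pos h.one_le).le
  have h1 := h.norm_interaction_le i (by norm_num : 2 ≤ 2)
  set X := smoothedError n 2 θs θ (θ.2 i) - θ.1 i * (fejerDeriv n 2 0 : ℂ)
        + θs.1 i * (fejerDeriv n 2 (θ.2 i - θs.2 i) : ℂ) with hX
  have h2 : hessTT (loss n θs) θ i i - (((starRingEnd ℂ (θ.1 i) * θs.1 i).re *
        -fejerDeriv n 2 (θ.2 i - θs.2 i) : ℝ) : ℂ)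
      = ((starRingEnd ℂ (θ.1 i) * X).re : ℂ) := by
    rw [hessTT_loss, if_pos rfl, sub_self, ← Complex.ofReal_sub, ← Complex.re_mul_ofReal,
      ← Complex.sub_re, hX]
    congr 2
    push_cast
    ring
  rw [h2, Complex.norm_real]
  refine (Complex.abs_re_le_norm _).trans ?_
  rw [norm_mul, RCLike.norm_conj]
  refine mul_le_mul (h.amp_le i) (h1.trans (le_of_eq ?_)) (norm_nonneg _)
    (mul_nonneg (by linarith [h.eps_nonneg]) (norm_nonneg _))
  rw [hc]
  norm_num [decayConst]

/-- Row sums of the upper half of the scaled Hessian. -/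
lemma amp_row_le (h : IsNear n θs θ ε R η w) (i : Fin r) (hi : θs.1 i ≠ 0) :
    ∑ j, ‖(θs.1 i)⁻¹ * hessAA (loss n θs) θ i j * θs.1 j - if i = j then 1 else 0‖
      + ∑ j, ‖(θs.1 i)⁻¹ * hessAT (loss n θs) θ i j * ((Real.sqrt (curv n) : ℝ) : ℂ)⁻¹‖
      ≤ ε + (0.93 + 2.55 * ε) * (R * (4 * η)) := by
  have hs := h.sqrt_pos
  have hs2 := Real.mul_self_sqrt (curv_pos h.one_le).le
  set s := Real.sqrt (curv n) with hsdef
  have hA : 0 < ‖θs.1 i‖ := norm_pos_iff.mpr hi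
  have hsum := mul_le_mul_of_nonneg_left (h.sum_norm_mul_le i) (inv_nonneg.mpr hA.le)
  rw [inv_mul_cancel_left₀ hA.ne'] at hsum
  have hε := h.eps_nonneg
  have e1 : ∑ j, ‖(θs.1 i)⁻¹ * hessAA (loss n θs) θ i j * θs.1 j - if i = j then 1 else 0‖
      ≤ 0.37 * (R * (4 * η)) := by
    rw [← Finset.add_sum_erase _ _ (Finset.mem_univ i)]
    have hd : (θs.1 i)⁻¹ * hessAA (loss n θs) θ i i * θs.1 i - (if i = i then 1 else 0) = 0 := by
      rw [hessAA_loss, sub_self, fejerDeriv_zero_zero, if_pos rfl, Complex.ofReal_one, mul_one,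
        inv_mul_cancel₀ hi, sub_self]
    rw [hd, norm_zero, zero_add]
    calc _ ≤ ∑ j ∈ Finset.univ.erase i, 0.37 * (‖θs.1 i‖⁻¹ * (‖θs.1 j‖ * w i j)) := by
          refine Finset.sum_le_sum fun j hj => ?_
          have hij := (Finset.ne_of_mem_erase hj).symm
          rw [if_neg hij, sub_zero, norm_mul, norm_mul, norm_inv]
          calc _ ≤ ‖θs.1 i‖⁻¹ * (0.37 * w i j) * ‖θs.1 j‖ := by
                gcongr
                exact h.norm_hessAA_le hij
            _ = _ := by ring
      _ ≤ _ := by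
          rw [← Finset.mul_sum, ← Finset.mul_sum]
          exact mul_le_mul_of_nonneg_left hsum (by norm_num)
  have hF : |fejerDeriv n 1 (θ.2 i - θs.2 i)| ≤ s * ε := by
    refine (abs_fejerDeriv_one_le n _).trans ?_
    rw [← hs2, mul_assoc]
    exact mul_le_mul_of_nonneg_left (h.loc i) hs.le
  have e2 : ∑ j, ‖(θs.1 i)⁻¹ * hessAT (loss n θs) θ i j * ((s : ℝ) : ℂ)⁻¹‖
      ≤ (ε + ε * 1.99 * (R * (4 * η))) + (1 + ε) * 0.56 * (R * (4 * η)) := by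
    rw [← Finset.add_sum_erase _ _ (Finset.mem_univ i)]
    have hn : ∀ j, ‖(θs.1 i)⁻¹ * hessAT (loss n θs) θ i j * ((s : ℝ) : ℂ)⁻¹‖
        = ‖θs.1 i‖⁻¹ * ‖hessAT (loss n θs) θ i j‖ * s⁻¹ := by
      intro j
      rw [norm_mul, norm_mul, norm_inv, norm_inv, Complex.norm_real, Real.norm_eq_abs,
        abs_of_pos hs]
    simp only [hn]
    refine add_le_add ?_ ?_
    · calc _ ≤ ‖θs.1 i‖⁻¹ * (‖θs.1 i‖ * (s * ε)
            + ε * 1.99 * s * (‖θs.1 i‖ * (R * (4 * η)))) * s⁻¹ := by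
            gcongr
            exact (h.norm_hessAT_self_le i).trans (by gcongr)
        _ = _ := by field_simp
    · calc _ ≤ ∑ j ∈ Finset.univ.erase i,
            (1 + ε) * 0.56 * (‖θs.1 i‖⁻¹ * (‖θs.1 j‖ * w i j)) := by
            refine Finset.sum_le_sum fun j hj => ?_
            have hij := (Finset.ne_of_mem_erase hj).symm
            calc _ ≤ ‖θs.1 i‖⁻¹ * ((1 + ε) * ‖θs.1 j‖ * (0.56 * s * w i j)) * s⁻¹ := by
                  gcongr
                  exact h.norm_hessAT_le hij
              _ = _ := by field_simp
        _ ≤ _ := by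
            rw [← Finset.mul_sum, ← Finset.mul_sum]
            exact mul_le_mul_of_nonneg_left hsum (by positivity)
  refine (add_le_add e1 e2).trans (le_of_eq ?_)
  ring

/-- Row sums of the lower half of the scaled Hessian; `K` stands for `|a_k|⁻²`. -/
lemma loc_row_le (h : IsNear n θs θ ε R η w) (i : Fin r) {K B : ℝ} (hK : 0 ≤ K)
    (hB : K * ‖θs.1 i‖ ^ 2 * (|fejerDeriv n 1 (θ.2 i - θs.2 i)| / Real.sqrt (curv n)) +
      |K * ((starRingEnd ℂ (θ.1 i) * θs.1 i).re * (-fejerDeriv n 2 (θ.2 i - θs.2 i) / curv n)) - 1|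
      ≤ B) :
    ∑ j, ‖((Real.sqrt (curv n) : ℝ) : ℂ) * (((curv n)⁻¹ * K : ℝ) : ℂ) *
        star (hessAT (loss n θs) θ j i) * θs.1 j‖
      + ∑ j, ‖((Real.sqrt (curv n) : ℝ) : ℂ) * (((curv n)⁻¹ * K : ℝ) : ℂ) *
        hessTT (loss n θs) θ i j * ((Real.sqrt (curv n) : ℝ) : ℂ)⁻¹ - if i = j then 1 else 0‖
      ≤ B + K * ‖θs.1 i‖ ^ 2 * ((1.99 + 10.81 * ε + 6.83 * ε ^ 2) * (R * (4 * η))) := by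
  have hs := h.sqrt_pos
  have hs2 := Real.mul_self_sqrt (curv_pos h.one_le).le
  have hc0 := curv_pos h.one_le
  set s := Real.sqrt (curv n) with hsdef
  set c := curv n with hcdef
  have hε := h.eps_nonneg
  have hsum := h.sum_norm_mul_le i
  have hn1 : ∀ j, ‖((s : ℝ) : ℂ) * ((c⁻¹ * K : ℝ) : ℂ) *
        star (hessAT (loss n θs) θ j i) * θs.1 j‖
      = K * s⁻¹ * ‖hessAT (loss n θs) θ j i‖ * ‖θs.1 j‖ := by
    intro j
    rw [norm_mul, norm_mul, norm_star, ← Complex.ofReal_mul, Complex.norm_real, Real.norm_eq_abs,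
      abs_of_nonneg (by positivity), ← hs2]
    field_simp
  have hsC : (s : ℂ) ≠ 0 := by exact_mod_cast hs.ne'
  have hn2 : ∀ j, ((s : ℝ) : ℂ) * ((c⁻¹ * K : ℝ) : ℂ) * hessTT (loss n θs) θ i j * ((s : ℝ) : ℂ)⁻¹
      = ((c⁻¹ * K : ℝ) : ℂ) * hessTT (loss n θs) θ i j := by
    intro j
    field_simp
  simp only [hn1, hn2]
  have e1 : ∑ j, K * s⁻¹ * ‖hessAT (loss n θs) θ j i‖ * ‖θs.1 j‖
      ≤ K * ‖θs.1 i‖ ^ 2 * (|fejerDeriv n 1 (θ.2 i - θs.2 i)| / s)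
        + K * ‖θs.1 i‖ ^ 2 * (ε * 1.99 * (R * (4 * η)))
        + K * ‖θs.1 i‖ ^ 2 * ((1 + ε) * 0.56 * (R * (4 * η))) := by
    rw [← Finset.add_sum_erase _ _ (Finset.mem_univ i)]
    refine add_le_add ?_ ?_
    · calc _ ≤ K * s⁻¹ * (‖θs.1 i‖ * |fejerDeriv n 1 (θ.2 i - θs.2 i)|
              + ε * 1.99 * s * (‖θs.1 i‖ * (R * (4 * η)))) * ‖θs.1 i‖ := by
            gcongr
            exact h.norm_hessAT_self_le i
        _ = _ := by field_simp
    · calc _ ≤ ∑ j ∈ Finset.univ.erase i,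
              K * ‖θs.1 i‖ * ((1 + ε) * 0.56) * (‖θs.1 j‖ * w i j) := by
            refine Finset.sum_le_sum fun j hj => ?_
            have hij := (Finset.ne_of_mem_erase hj).symm
            calc _ ≤ K * s⁻¹ * ((1 + ε) * ‖θs.1 i‖ * (0.56 * s * w i j)) * ‖θs.1 j‖ := by
                  gcongr
                  exact h.norm_hessAT_swap_le hij
              _ = _ := by field_simp
        _ ≤ K * ‖θs.1 i‖ * ((1 + ε) * 0.56) * (‖θs.1 i‖ * (R * (4 * η))) := by
            rw [← Finset.mul_sum]
            gcongr
        _ = _ := by ring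
  have e2 : ∑ j, ‖((c⁻¹ * K : ℝ) : ℂ) * hessTT (loss n θs) θ i j - if i = j then 1 else 0‖
      ≤ |K * ((starRingEnd ℂ (θ.1 i) * θs.1 i).re *
          (-fejerDeriv n 2 (θ.2 i - θs.2 i) / c)) - 1|
        + K * ‖θs.1 i‖ ^ 2 * ((1 + ε) * (ε * 5.4) * (R * (4 * η)))
        + K * ‖θs.1 i‖ ^ 2 * ((1 + ε) ^ 2 * 1.43 * (R * (4 * η))) := by
    rw [← Finset.add_sum_erase _ _ (Finset.mem_univ i)]
    refine add_le_add ?_ ?_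
    · set Q : ℝ := (starRingEnd ℂ (θ.1 i) * θs.1 i).re * -fejerDeriv n 2 (θ.2 i - θs.2 i) with hQ
      have hsplit : ((c⁻¹ * K : ℝ) : ℂ) * hessTT (loss n θs) θ i i - (if i = i then 1 else 0)
          = ((K * ((starRingEnd ℂ (θ.1 i) * θs.1 i).re *
          (-fejerDeriv n 2 (θ.2 i - θs.2 i) / c)) - 1 : ℝ) : ℂ)
            + ((c⁻¹ * K : ℝ) : ℂ) * (hessTT (loss n θs) θ i i - (Q : ℂ)) := by
        rw [if_pos rfl, hQ]
        push_cast
        ring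
      rw [hsplit]
      refine (norm_add_le _ _).trans ?_
      rw [Complex.norm_real, Real.norm_eq_abs, norm_mul, Complex.norm_real, Real.norm_eq_abs,
        abs_of_nonneg (by positivity : 0 ≤ c⁻¹ * K)]
      refine add_le_add_right ?_ _
      calc _ ≤ c⁻¹ * K * ((1 + ε) * ‖θs.1 i‖ * (ε * 5.4 * c * (‖θs.1 i‖ * (R * (4 * η))))) := by
            gcongr
            exact h.abs_hessTT_self_sub_le i
        _ = _ := by field_simp
    · calc _ ≤ ∑ j ∈ Finset.univ.erase i,
              K * ‖θs.1 i‖ * ((1 + ε) ^ 2 * 1.43) * (‖θs.1 j‖ * w i j) := by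
            refine Finset.sum_le_sum fun j hj => ?_
            have hij := (Finset.ne_of_mem_erase hj).symm
            rw [if_neg hij, sub_zero, norm_mul, Complex.norm_real, Real.norm_eq_abs,
              abs_of_nonneg (by positivity : 0 ≤ c⁻¹ * K)]
            calc _ ≤ c⁻¹ * K * ((1 + ε) ^ 2 * ‖θs.1 i‖ * ‖θs.1 j‖ * (1.43 * c * w i j)) := by
                  gcongr
                  exact h.norm_hessTT_le hij
              _ = _ := by field_simp
        _ ≤ K * ‖θs.1 i‖ * ((1 + ε) ^ 2 * 1.43) * (‖θs.1 i‖ * (R * (4 * η))) := by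
            rw [← Finset.mul_sum]
            gcongr
        _ = _ := by ring
  refine (add_le_add e1 e2).trans ?_
  refine le_trans (le_of_eq ?_) (add_le_add_left hB _)
  ring

end IsNear

/-! ### Verification of the hypotheses and conclusion -/

lemma single_spike_complex {n : ℕ} (hn : 1 ≤ n) {as ak a : ℂ} (has : as ≠ 0) {ε u δ : ℝ}
    (hε1 : ε < 1) (hu0 : 0 ≤ u) (hu1 : u ≤ 1) (hak : ‖ak - as‖ ≤ ε * ‖as‖)
    (ha : a = as + u * (ak - as)) (hδ : Real.sqrt (curv n) * |δ| ≤ u * ε) :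
    (‖ak‖ ^ 2)⁻¹ * ‖as‖ ^ 2 * (|fejerDeriv n 1 δ| / Real.sqrt (curv n)) +
      |(‖ak‖ ^ 2)⁻¹ * ((starRingEnd ℂ a * as).re * (-fejerDeriv n 2 δ / curv n)) - 1|
      ≤ 1 / (1 - ε) ^ 2 - 1 ∧
    (‖ak‖ ^ 2)⁻¹ * ‖as‖ ^ 2 ≤ 1 / (1 - ε) ^ 2 := by
  have hc := curv_pos hn
  have hs : 0 < Real.sqrt (curv n) := Real.sqrt_pos.mpr hc
  have hs2 := Real.sq_sqrt hc.le
  set s := Real.sqrt (curv n) with hsdef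
  have hA : 0 < ‖as‖ := norm_pos_iff.mpr has
  obtain ⟨β, hβ⟩ : ∃ β : ℂ, ak = as * (1 + β) := ⟨(ak - as) / as, by field_simp; ring⟩
  have hβn : ‖β‖ ≤ ε := by
    have h1 : ak - as = as * β := by rw [hβ]; ring
    rw [h1, norm_mul, mul_comm] at hak
    exact le_of_mul_le_mul_right hak hA
  have hε0 : 0 ≤ ε := (norm_nonneg _).trans hβn
  have hb : |β.re| ≤ ε := (Complex.abs_re_le_norm β).trans hβn
  have hVeq : ‖1 + β‖ ^ 2 = 1 + 2 * β.re + ‖β‖ ^ 2 := by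
    rw [← Complex.normSq_eq_norm_sq, ← Complex.normSq_eq_norm_sq, Complex.normSq_apply,
      Complex.normSq_apply]
    simp
    ring
  have hV : (1 + β.re) ^ 2 ≤ ‖1 + β‖ ^ 2 := by
    have := Complex.abs_re_le_norm (1 + β)
    rw [← sq_abs]
    exact pow_le_pow_left₀ (abs_nonneg _) (by simpa using this) 2
  have hV' : ‖1 + β‖ ^ 2 ≤ 1 + 2 * β.re + ε ^ 2 := by
    rw [hVeq]
    linarith [pow_le_pow_left₀ (norm_nonneg β) hβn 2]
  have hK : (‖ak‖ ^ 2)⁻¹ * ‖as‖ ^ 2 = (‖1 + β‖ ^ 2)⁻¹ := by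
    rw [hβ, norm_mul, mul_pow, mul_inv]
    field_simp
  have hre : (starRingEnd ℂ a * as).re = ‖as‖ ^ 2 * (1 + u * β.re) := by
    have h1 : starRingEnd ℂ a * as = (starRingEnd ℂ as * as) * (1 + u * starRingEnd ℂ β) := by
      rw [ha, hβ]
      simp only [map_add, map_mul, map_sub, Complex.conj_ofReal, map_one]
      ring
    rw [h1, ← Complex.normSq_eq_conj_mul_self, Complex.re_ofReal_mul, Complex.normSq_eq_norm_sq]
    simp
  have hδ' : |δ| * s ≤ u * ε := by rwa [mul_comm]
  have hx : |fejerDeriv n 1 δ| / s ≤ u * ε := by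
    rw [div_le_iff₀ hs]
    refine (abs_fejerDeriv_one_le n δ).trans ?_
    rw [← hs2]
    nlinarith
  have hρ1 : -fejerDeriv n 2 δ / curv n ≤ 1 := by
    rw [div_le_one hc]
    exact (neg_le_abs _).trans (abs_fejerDeriv_two_le n δ)
  have hρ : 1 - 6 / 5 * (u * ε) ^ 2 ≤ -fejerDeriv n 2 δ / curv n := by
    rw [le_div_iff₀ hc]
    refine le_trans ?_ (neg_fejerDeriv_two_ge n δ)
    have h1 : curv n * δ ^ 2 ≤ (u * ε) ^ 2 := by
      rw [← hs2, ← sq_abs δ, ← mul_pow]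
      exact pow_le_pow_left₀ (by positivity) hδ 2
    nlinarith
  have key := single_spike_bound hε0 hε1 hu0 hu1 hb hV hV' hx hρ hρ1
  refine ⟨?_, ?_⟩
  · have h1 : (‖ak‖ ^ 2)⁻¹ * ((starRingEnd ℂ a * as).re * (-fejerDeriv n 2 δ / curv n))
        = (‖1 + β‖ ^ 2)⁻¹ * (-fejerDeriv n 2 δ / curv n * (1 + u * β.re)) := by
      rw [hre, ← hK]
      ring
    rw [h1, hK]
    exact key
  · rw [hK, one_div]
    refine inv_anti₀ (pow_pos (by linarith) 2) (le_trans ?_ hV)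
    exact pow_le_pow_left₀ (by linarith) (by linarith [(abs_le.mp hb).1]) 2

lemma exists_real_sep {r : ℕ} (τ : Fin r → ℝ) {n : ℕ}
    (h : ENNReal.ofReal 4.7 ≤ ((n : ℝ≥0∞) + 1) * sep τ) {i l : Fin r} (hil : i ≠ l) :
    ∃ Δ : ℝ, sep τ = ENNReal.ofReal Δ ∧ 0 < Δ ∧ 4.7 ≤ ((n : ℝ) + 1) * Δ ∧
      ∀ l l', l ≠ l' → ∀ p : ℤ, Δ ≤ |τ l - τ l' + p| := by
  have hle : ∀ l l', l ≠ l' → sep τ ≤ ENNReal.ofReal (⨅ p : ℤ, |τ l - τ l' + p|) :=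
    fun l l' hne => iInf_le_of_le l (iInf_le_of_le l' (iInf_le_of_le hne le_rfl))
  have htop : sep τ ≠ ⊤ := ne_top_of_le_ne_top ENNReal.ofReal_ne_top (hle i l hil)
  have hn : ((n : ℝ≥0∞) + 1) = ENNReal.ofReal ((n : ℝ) + 1) := by
    rw [ENNReal.ofReal_add (by positivity) zero_le_one]
    simp
  have h47 : 4.7 ≤ ((n : ℝ) + 1) * (sep τ).toReal := by
    rw [← ENNReal.ofReal_toReal htop, hn, ← ENNReal.ofReal_mul (by positivity)] at h
    exact (ENNReal.ofReal_le_ofReal_iff (by positivity)).mp h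
  refine ⟨(sep τ).toReal, (ENNReal.ofReal_toReal htop).symm, ?_, h47, fun l l' hne p => ?_⟩
  · by_contra hneg
    have : (sep τ).toReal = 0 := le_antisymm (not_lt.mp hneg) ENNReal.toReal_nonneg
    rw [this, mul_zero] at h47
    norm_num at h47
  · have hbdd : BddBelow (Set.range fun p : ℤ => |τ l - τ l' + p|) :=
      ⟨0, by rintro _ ⟨p, rfl⟩; exact abs_nonneg _⟩
    exact (ENNReal.toReal_le_of_le_ofReal (Real.iInf_nonneg fun p => abs_nonneg _)
      (hle l l' hne)).trans (ciInf_le hbdd p)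

/-- The decay weights attached to the true locations. -/
noncomputable def decayWeight (n : ℕ) {r : ℕ} (τ : Fin r → ℝ) (i l : Fin r) : ℝ :=
  1 / (((n : ℝ) + 1) * wrapDist (τ i - τ l)) ^ 2

lemma sum_decayWeight_le {n r : ℕ} (τ : Fin r → ℝ)
    (h : ENNReal.ofReal 4.7 ≤ ((n : ℝ≥0∞) + 1) * sep τ) (i : Fin r) :
    ∑ l ∈ Finset.univ.erase i, decayWeight n τ i l
      ≤ 4 * (((((n : ℝ≥0∞) + 1) * sep τ) ^ 2)⁻¹).toReal := by
  rcases (Finset.univ.erase i).eq_empty_or_nonempty with he | ⟨l, hl⟩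
  · rw [he, Finset.sum_empty]
    exact mul_nonneg (by norm_num) ENNReal.toReal_nonneg
  · obtain ⟨Δ, hΔ, hΔ0, -, hsep⟩ := exists_real_sep τ h (Finset.ne_of_mem_erase hl).symm
    have hη : (((((n : ℝ≥0∞) + 1) * sep τ) ^ 2)⁻¹).toReal = 1 / (((n : ℝ) + 1) * Δ) ^ 2 := by
      rw [hΔ, ENNReal.toReal_inv, ENNReal.toReal_pow, ENNReal.toReal_mul,
        ENNReal.toReal_ofReal hΔ0.le, ENNReal.toReal_add (by simp) (by simp), one_div]
      simp
    have h1 := sum_inv_wrapDist_sq_le τ hΔ0 hsep i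
    calc _ = 1 / ((n : ℝ) + 1) ^ 2 *
          ∑ l ∈ Finset.univ.erase i, 1 / wrapDist (τ i - τ l) ^ 2 := by
          rw [Finset.mul_sum]
          refine Finset.sum_congr rfl fun l _ => ?_
          rw [decayWeight, mul_pow, one_div_mul_one_div]
      _ ≤ 1 / ((n : ℝ) + 1) ^ 2 * (4 / Δ ^ 2) := mul_le_mul_of_nonneg_left h1 (by positivity)
      _ = _ := by
          rw [hη]
          field_simp

lemma abs_fejerDeriv_le_decayWeight {n r : ℕ} (τ : Fin r → ℝ)
    (h : ENNReal.ofReal 4.7 ≤ ((n : ℝ≥0∞) + 1) * sep τ) {i l : Fin r} (hil : i ≠ l) {x : ℝ}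
    (hx : Real.sqrt (curv n) * |x - (τ i - τ l)| ≤ 2) {m : ℕ} (hm : m ≤ 3) :
    |fejerDeriv n m x| ≤ decayConst m * Real.sqrt (curv n) ^ m * decayWeight n τ i l := by
  obtain ⟨Δ, -, hΔ0, h47, hsep⟩ := exists_real_sep τ h hil
  have h1 : Δ ≤ wrapDist (τ i - τ l) := by
    have := hsep i l hil (-round (τ i - τ l))
    simpa [wrapDist, sub_eq_add_neg] using this
  have h2 : wrapDist (τ i - τ l) ≤ 1 / 2 := abs_sub_round _
  have hn0 : (0 : ℝ) ≤ (n : ℝ) + 1 := by positivity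
  have hn : 9 ≤ n := by
    have : (8 : ℝ) < n := by nlinarith
    exact_mod_cast this
  exact abs_fejerDeriv_le_of_near hn
    (h47.trans (mul_le_mul_of_nonneg_left h1 hn0)) hx hm

lemma norm_le_dynRange_mul {r : ℕ} (a : Fin r → ℂ) (ha : ∀ j, a j ≠ 0) (i j : Fin r) :
    ‖a j‖ ≤ dynRange a * ‖a i‖ := by
  have : Nonempty (Fin r) := ⟨i⟩
  have h1 : ‖a j‖ ≤ ⨆ l, ‖a l‖ := le_ciSup (Finite.bddAbove_range fun l => ‖a l‖) j
  have h2 : (⨅ l, ‖a l‖) ≤ ‖a i‖ := ciInf_le (Finite.bddBelow_range fun l => ‖a l‖) i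
  have h3 : 0 < ⨅ l, ‖a l‖ := by
    obtain ⟨l, hl⟩ := exists_eq_ciInf_of_finite (f := fun l => ‖a l‖)
    rw [← hl]
    exact norm_pos_iff.mpr (ha l)
  rw [dynRange, div_mul_eq_mul_div, le_div_iff₀ h3]
  exact mul_le_mul h1 h2 h3.le ((norm_nonneg _).trans h1)

lemma norm_amp_sub_le_err {n r : ℕ} {θs θk : Param r} (i : Fin r) (hi : θs.1 i ≠ 0) :
    ‖θk.1 i - θs.1 i‖ ≤ err n θs θk * ‖θs.1 i‖ := by
  have h := norm_le_pi_norm (scaling n θs *ᵥ (toVec θk - toVec θs)) (Sum.inl i)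
  rw [scaling, Matrix.mulVec_diagonal] at h
  simp only [Sum.elim_inl, toVec, Pi.sub_apply, norm_mul, norm_inv] at h
  rw [inv_mul_le_iff₀ (norm_pos_iff.mpr hi)] at h
  rw [mul_comm]
  exact h

lemma sqrt_curv_mul_abs_sub_le_err {n r : ℕ} {θs θk : Param r} (i : Fin r) :
    Real.sqrt (curv n) * |θk.2 i - θs.2 i| ≤ err n θs θk := by
  have h := norm_le_pi_norm (scaling n θs *ᵥ (toVec θk - toVec θs)) (Sum.inr i)
  rw [scaling, Matrix.mulVec_diagonal] at h
  simp only [Sum.elim_inr, toVec, Pi.sub_apply, norm_mul, ← Complex.ofReal_sub,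
    Complex.norm_real, Real.norm_eq_abs, abs_of_nonneg (Real.sqrt_nonneg _)] at h
  exact h

lemma scaling_inv {n r : ℕ} (hn : 1 ≤ n) (θs : Param r) (h0 : ∀ j, θs.1 j ≠ 0) :
    (scaling n θs)⁻¹ = Matrix.diagonal
      (Sum.elim θs.1 (fun _ => ((Real.sqrt (curv n) : ℝ) : ℂ)⁻¹)) := by
  have hs : ((Real.sqrt (curv n) : ℝ) : ℂ) ≠ 0 := by
    exact_mod_cast (Real.sqrt_pos.mpr (curv_pos hn)).ne'
  refine Matrix.inv_eq_right_inv ?_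
  rw [scaling, Matrix.diagonal_mul_diagonal, ← Matrix.diagonal_one]
  congr 1
  funext i
  rcases i with i | i
  · exact inv_mul_cancel₀ (h0 i)
  · exact mul_inv_cancel₀ hs

lemma linfty_opNorm_le_of_row_sums {m : Type*} [Fintype m] [Nonempty m] (A : Matrix m m ℂ) {B : ℝ}
    (h : ∀ i, ∑ j, ‖A i j‖ ≤ B) : ‖A‖ ≤ B := by
  have hB : 0 ≤ B := (Finset.sum_nonneg fun j _ => norm_nonneg _).trans (h (Classical.arbitrary m))
  lift B to NNReal using hB
  rw [Matrix.linfty_opNorm_def]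
  refine NNReal.coe_le_coe.mpr (Finset.sup_le fun i _ => ?_)
  rw [← NNReal.coe_le_coe]
  push_cast
  exact h i

lemma preconditioned_hessian_bound {n r : ℕ} {θs θk θ : Param r} (hn : 1 ≤ n) (hr : 1 ≤ r)
    (h0 : ∀ j, θs.1 j ≠ 0) (hsep : ENNReal.ofReal 4.7 ≤ ((n : ℝ≥0∞) + 1) * sep θs.2)
    (herr : err n θs θk < 1) (hθ : θ ∈ segment ℝ θs θk) :
    ‖scaling n θs * precond n θk * hessian (loss n θs) θ * (scaling n θs)⁻¹ - 1‖
      ≤ 1 / (1 - err n θs θk) ^ 2 - 1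
        + (4 * 2.32 + 75.80 * err n θs θk) * dynRange θs.1
          * (((((n : ℝ≥0∞) + 1) * sep θs.2) ^ 2)⁻¹).toReal / (1 - err n θs θk) ^ 2 := by
  have hne : Nonempty (Fin r) := ⟨⟨0, hr⟩⟩
  rw [segment_eq_image'] at hθ
  obtain ⟨u, ⟨hu0, hu1⟩, rfl⟩ := hθ
  set θ : Param r := θs + u • (θk - θs) with hθdef
  have hε0 : 0 ≤ err n θs θk := norm_nonneg _
  have hamp := fun i => norm_amp_sub_le_err (n := n) (θk := θk) i (h0 i)
  have hloc := fun i => sqrt_curv_mul_abs_sub_le_err (n := n) (θs := θs) (θk := θk) i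
  set ε := err n θs θk with hε
  set η := (((((n : ℝ≥0∞) + 1) * sep θs.2) ^ 2)⁻¹).toReal with hη
  set R := dynRange θs.1 with hR
  have hη0 : 0 ≤ η := ENNReal.toReal_nonneg
  have hR0 : 0 ≤ R := div_nonneg (Real.iSup_nonneg fun l => norm_nonneg _)
    (Real.iInf_nonneg fun l => norm_nonneg _)
  have ha : ∀ i, θ.1 i = θs.1 i + u * (θk.1 i - θs.1 i) := fun i => by simp [hθdef]
  have hτ : ∀ i, θ.2 i - θs.2 i = u * (θk.2 i - θs.2 i) := fun i => by simp [hθdef]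
  have hlocu : ∀ i, Real.sqrt (curv n) * |θ.2 i - θs.2 i| ≤ u * ε := fun i => by
    rw [hτ, abs_mul, abs_of_nonneg hu0, mul_left_comm]
    exact mul_le_mul_of_nonneg_left (hloc i) hu0
  have hnear : IsNear n θs θ ε R η (decayWeight n θs.2) :=
    { one_le := hn
      eps_nonneg := hε0
      eps_le_one := herr.le
      amp := fun l => by
        rw [ha, add_sub_cancel_left, norm_mul, Complex.norm_real, Real.norm_eq_abs,
          abs_of_nonneg hu0]
        exact (mul_le_of_le_one_left (norm_nonneg _) hu1).trans (hamp l)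
      loc := fun l => (hlocu l).trans (mul_le_of_le_one_left hε0 hu1)
      range := norm_le_dynRange_mul θs.1 h0
      decay := fun i l hil x hx m hm => abs_fejerDeriv_le_decayWeight θs.2 hsep hil hx hm
      nonneg := fun i l => by unfold decayWeight; positivity
      sum_le := sum_decayWeight_le θs.2 hsep }
  have he : 0 < (1 - ε) ^ 2 := pow_pos (by linarith) 2
  have hq : 1 ≤ 1 / (1 - ε) ^ 2 := by
    rw [le_div_iff₀ he]
    nlinarith
  have hRη : 0 ≤ R * η := mul_nonneg hR0 hη0
  refine linfty_opNorm_le_of_row_sums _ fun i => ?_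
  rw [Fintype.sum_sum_type, scaling_inv hn θs h0, scaling, precond, Matrix.diagonal_mul_diagonal]
  rcases i with i | i
  · simp only [hessian, Matrix.sub_apply, Matrix.mul_diagonal, Matrix.diagonal_mul,
      Matrix.fromBlocks_apply₁₁, Matrix.fromBlocks_apply₁₂, Sum.elim_inl, Sum.elim_inr,
      Matrix.one_apply, Sum.inl.injEq, reduceCtorEq, if_false, sub_zero, mul_one]
    refine (hnear.amp_row_le i (h0 i)).trans (add_le_add ?_ ?_)
    · rw [le_sub_iff_add_le, le_div_iff₀ he]
      nlinarith [mul_nonneg hε0 hε0]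
    · calc (0.93 + 2.55 * ε) * (R * (4 * η)) = (3.72 + 10.2 * ε) * (R * η) := by ring
        _ ≤ (4 * 2.32 + 75.80 * ε) * (R * η) :=
          mul_le_mul_of_nonneg_right (by linarith) hRη
        _ ≤ (4 * 2.32 + 75.80 * ε) * (R * η) * (1 / (1 - ε) ^ 2) :=
          le_mul_of_one_le_right (by positivity) hq
        _ = _ := by ring
  · simp only [hessian, Matrix.sub_apply, Matrix.mul_diagonal, Matrix.diagonal_mul,
      Matrix.fromBlocks_apply₂₁, Matrix.fromBlocks_apply₂₂, Sum.elim_inl, Sum.elim_inr,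
      Matrix.one_apply, Sum.inr.injEq, reduceCtorEq, if_false, sub_zero,
      Matrix.conjTranspose_apply]
    obtain ⟨hB, hK⟩ := single_spike_complex hn (h0 i) herr hu0 hu1 (hamp i) (ha i) (hlocu i)
    refine (hnear.loc_row_le i (by positivity) hB).trans (add_le_add_right ?_ _)
    calc _ ≤ 1 / (1 - ε) ^ 2 * ((1.99 + 10.81 * ε + 6.83 * ε ^ 2) * (R * (4 * η))) :=
          mul_le_mul_of_nonneg_right hK (by positivity)
      _ = (7.96 + 43.24 * ε + 27.32 * ε ^ 2) * (R * η) * (1 / (1 - ε) ^ 2) := by ring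
      _ ≤ (4 * 2.32 + 75.80 * ε) * (R * η) * (1 / (1 - ε) ^ 2) := by
          refine mul_le_mul_of_nonneg_right (mul_le_mul_of_nonneg_right ?_ hRη) (by positivity)
          nlinarith
      _ = _ := by ring

end SpikeDeconv

theorem theorem4 :
    ∃ KΔ Kθ : ℝ, 0 < KΔ ∧ KΔ ≤ 2.32 ∧ 0 < Kθ ∧ Kθ ≤ 75.80 ∧
      ∀ (n r : ℕ) (θs θk : SpikeDeconv.Param r),
        2 ≤ n → 1 ≤ r →
        (∀ j, θs.1 j ≠ 0) →
        ENNReal.ofReal 4.7 ≤ ((n : ℝ≥0∞) + 1) * SpikeDeconv.sep θs.2 →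
        SpikeDeconv.err n θs θk < 1 →
        ∀ θ ∈ segment ℝ θs θk,
          ENNReal.ofReal ‖θ.2 - θs.2‖ ≤ SpikeDeconv.sep θs.2 / 4 →
          ‖SpikeDeconv.scaling n θs * SpikeDeconv.precond n θk *
                SpikeDeconv.hessian (SpikeDeconv.loss n θs) θ * (SpikeDeconv.scaling n θs)⁻¹
              - 1‖
            ≤ 1 / (1 - SpikeDeconv.err n θs θk) ^ 2 - 1
              + (4 * KΔ + Kθ * SpikeDeconv.err n θs θk) * SpikeDeconv.dynRange θs.1
                * (((((n : ℝ≥0∞) + 1) * SpikeDeconv.sep θs.2) ^ 2)⁻¹).toReal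
                / (1 - SpikeDeconv.err n θs θk) ^ 2 :=
  ⟨2.32, 75.80, by norm_num, le_rfl, by norm_num, le_rfl,
    fun _ _ _ _ hn hr h0 hsep herr _ hθ _ =>
      SpikeDeconv.preconditioned_hessian_bound (by omega) hr h0 hsep herr hθ⟩
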